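/- Let anti-de Sitter 3-space be $\mathrm{SL}(2,\mathbb R)$ with the bi-invariant Lorentz metric given by $q(X)=-\det X$ on $\mathfrak{sl}(2,\mathbb R)$. Consider smooth null curves $\gamma$ (that is, $\det(\gamma^{-1}\gamma')\equiv 0$) without flex points ($\gamma'$ and its covariant derivative along $\gamma$ are everywhere linearly independent) which admit a spinor frame, i.e. a smooth lift $(\Gamma_+,\Gamma_-)$ to $\mathrm{SL}(2,\mathbb R)\times\mathrm{SL}(2,\mathbb R)$ with $\gamma=\Gamma_+\Gamma_-^{-1}$ and $$\Gamma_\pm^{-1}d\Gamma_\pm=\begin{pmatrix}0&1\\ k\pm1&0\end{pmatrix}\omega ,$$ where the function $k$ is the curvature of $\gamma$ and the nowhere vanishing 1-form $\omega$ is its canonical arc element. An extremal trajectory with multiplier $m\in\mathbb R$ is such a curve, parametrized by the natural parameter ($\omega=ds$), with non-constant curvature, that is a critical point of $\mathcal L_m(\gamma)=\int_\gamma(m+k)\,\omega$ under compactly supported variations through curves of this kind (not necessarily naturally parametrized). Two trajectories $\gamma,\tilde\gamma:\mathbb R\to\mathrm{SL}(2,\mathbb R)$ are equivalent if $\tilde\gamma(s)=A\,\gamma(s+c)\,B^{-1}$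 for all $s$, for some $c\in\mathbb R$ and $A,B\in\mathrm{SL}(2,\mathbb R)$. Theorem. There exists a closed discrete subset $\mathcal M_0\subset\mathbb R$ such that, for every $m\in\mathbb R\setminus\mathcal M_0$, there exist countably infinitely many pairwise inequivalent periodic extremal trajectories $\gamma:\mathbb R\to\mathrm{SL}(2,\mathbb R)$ with multiplier $m$. -/

import Mathlib

open scoped MatrixGroups ContDiff

namespace AdS

/-- Real `2 × 2` matrices. -/
abbrev Mat := Matrix (Fin 2) (Fin 2) ℝ

/-- Parametrized curves in anti-de Sitter 3-space, modelled as `SL(2, ℝ)` with the bi-invariant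
Lorentz metric given on the Lie algebra by `q X = - det X`. -/
abbrev Curve := ℝ → SL(2, ℝ)

noncomputable section

/-- Entrywise derivative of a matrix-valued function. -/
def mderiv (V : ℝ → Mat) (t : ℝ) : Mat :=
  Matrix.of fun i j => deriv (fun s => V s i j) t

/-- Velocity `γ'` of a curve. -/
def velocity (γ : Curve) (t : ℝ) : Mat :=
  mderiv (fun s => (γ s : Mat)) t

/-- `γ⁻¹ γ'`. -/
def leftVelocity (γ : Curve) (t : ℝ) : Mat :=
  ((γ t)⁻¹ : SL(2, ℝ)) * velocity γ t

/-- Levi-Civita covariant derivative of a vector field `V` along `γ`. For the bi-invariant metric,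
with `v = γ⁻¹ V` and `X = γ⁻¹ γ'`, it is `γ (v' + [X, v] / 2)`. -/
def covDeriv (γ : Curve) (V : ℝ → Mat) (t : ℝ) : Mat :=
  (γ t : Mat) *
    (mderiv (fun s => (((γ s)⁻¹ : SL(2, ℝ)) : Mat) * V s) t +
      (1 / 2 : ℝ) • ⁅leftVelocity γ t, (((γ t)⁻¹ : SL(2, ℝ)) : Mat) * V t⁆)

/-- Smoothness of a curve in `SL(2, ℝ)`. -/
def IsSmooth (γ : Curve) : Prop :=
  ∀ i j, ContDiff ℝ ∞ (fun t => (γ t : Mat) i j)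

/-- Joint smoothness of a one-parameter family of curves in `SL(2, ℝ)`. -/
def IsSmoothFamily (γ : ℝ → Curve) : Prop :=
  ∀ i j, ContDiff ℝ ∞ (fun p : ℝ × ℝ => (γ p.1 p.2 : Mat) i j)

/-- Smooth null curves: `det (γ⁻¹ γ')` vanishes identically. -/
def IsNullCurve (γ : Curve) : Prop :=
  IsSmooth γ ∧ ∀ t, (leftVelocity γ t).det = 0

/-- No flex points: `γ'` and its covariant derivative are everywhere linearly independent. -/
def NoFlex (γ : Curve) : Prop :=
  ∀ t, LinearIndependent ℝ ![velocity γ t, covDeriv γ (velocity γ) t]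

/-- `(Γp, Γm)` is a spinor frame field along `γ`, with curvature function `k` and canonical arc
element `w dt`: it lifts `γ` and
`Γp⁻¹ dΓp = (0, 1; k + 1, 0) w dt`, `Γm⁻¹ dΓm = (0, 1; k - 1, 0) w dt`. -/
structure IsSpinorFrame (γ Γp Γm : Curve) (k w : ℝ → ℝ) : Prop where
  smooth_plus : IsSmooth Γp
  smooth_minus : IsSmooth Γm
  smooth_curvature : ContDiff ℝ ∞ k
  smooth_arc : ContDiff ℝ ∞ w
  arc_ne_zero : ∀ t, w t ≠ 0
  lift : ∀ t, γ t = Γp t * (Γm t)⁻¹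
  plus : ∀ t, leftVelocity Γp t = w t • !![0, 1; k t + 1, 0]
  minus : ∀ t, leftVelocity Γm t = w t • !![0, 1; k t - 1, 0]

/-- A variation of `γ` through null curves without flex points, supported in `[a, b]`, together
with the spinor frames, curvatures and arc elements of its members. -/
structure IsVariation (γ : Curve) (a b : ℝ) (F Γp Γm : ℝ → Curve) (k w : ℝ → ℝ → ℝ) :
    Prop where
  smooth : IsSmoothFamily F
  smooth_plus : IsSmoothFamily Γp
  smooth_minus : IsSmoothFamily Γm
  smooth_curvature : ContDiff ℝ ∞ (fun p : ℝ × ℝ => k p.1 p.2)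
  smooth_arc : ContDiff ℝ ∞ (fun p : ℝ × ℝ => w p.1 p.2)
  null : ∀ ε, IsNullCurve (F ε)
  noFlex : ∀ ε, NoFlex (F ε)
  frame : ∀ ε, IsSpinorFrame (F ε) (Γp ε) (Γm ε) (k ε) (w ε)
  start : F 0 = γ
  support : ∀ ε, ∀ t ∉ Set.Icc a b, F ε t = γ t

/-- `γ` is a critical point of the action `∫ (m + k) w dt` under compactly supported variations. -/
def IsCritical (m : ℝ) (γ : Curve) : Prop :=
  ∀ (a b : ℝ) (F Γp Γm : ℝ → Curve) (k w : ℝ → ℝ → ℝ), a < b →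
    IsVariation γ a b F Γp Γm k w →
      HasDerivAt (fun ε => ∫ t in a..b, (m + k ε t) * w ε t) 0 0

/-- Extremal trajectories with multiplier `m`, defined on the whole line: null curves without flex
points, parametrized by the natural parameter (the arc element is `dt`), with non-constant
curvature, that are critical for the action. -/
def IsTrajectory (m : ℝ) (γ : Curve) : Prop :=
  IsNullCurve γ ∧ NoFlex γ ∧
    (∃ (Γp Γm : Curve) (k : ℝ → ℝ),
      IsSpinorFrame γ Γp Γm k (fun _ => 1) ∧ ¬ ∃ c, ∀ s, k s = c) ∧
    IsCritical m γ

/-- Periodic (closed) curves. -/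
def IsPeriodic (γ : Curve) : Prop :=
  ∃ T > 0, Function.Periodic γ T

/-- Equivalence of curves: `γ₂ s = A γ₁(s + c) B⁻¹`. -/
def Equivalent (γ₁ γ₂ : Curve) : Prop :=
  ∃ (c : ℝ) (A B : SL(2, ℝ)), ∀ s, γ₂ s = A * γ₁ (s + c) * B⁻¹

end

end AdS

/-!
In a frame `Γ` with `Γ' = Γ X`, a matrix-valued `M` with `M' = [M, X]` is a constant conjugated by
`Γ`, a momentum. Pairing such an `M` of trace zero with the change of `X` under a compactly
supported variation gives an integral that vanishes to first order. The Euler-Lagrange equation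
`k₃ = 6 k k₁ - 2 m k₁` for the derivatives `k₁, k₂, k₃` of `k` says that each of the two spinor
frames has a momentum with entry `p - k`, where `p = m + 2` and `p = m - 2`, and the difference of
the two pairings is, up to a factor, the first variation of the action.

The curvature `k = c - δ cos φ` solves this equation if the phase `φ` runs at a suitable speed. The
square root of `p - k` is then, up to a factor, the amplitude of a frame in amplitude-phase form,
and the curve closes up as soon as both frames turn by rational multiples of `π` in one period of
`k`. Kepler's substitution of the true for the eccentric anomaly turns these angles into half the
integral of `1 / √(1 + ρ r)` along the ellipse `r = (1 - τ²) / (1 - τ cos ψ)`. The integral is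
strictly increasing in the eccentricity `τ` and tends to `2 π` as `τ → 1`.

As `c → -∞` the two angles agree. Fixing the angle for `p = m + 2` at `π q`, with `q < 1` rational
and close to `1`, leaves a curve of parameters from `c = -∞` to the place where `m - 2` meets the
maximum of `k`. Along it the angle for `p = m - 2` goes from `π q` to `π`, hence takes infinitely
many rational multiples of `π` as values. Equivalent curves have the same range of `k`, which
determines `c`, `δ` and with them the angle.
-/

namespace AdS

open scoped Matrix.Norms.Operator

section MatrixCalculus

lemma hasDerivAt_iff_entries {V : ℝ → Mat} {V' : Mat} {t : ℝ} :
    HasDerivAt V V' t ↔ ∀ i j, HasDerivAt (fun s => V s i j) (V' i j) t :=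
  hasDerivAt_pi.trans (forall_congr' fun _ => hasDerivAt_pi)

lemma mderiv_eq {V : ℝ → Mat} {V' : Mat} {t : ℝ} (h : HasDerivAt V V' t) : mderiv V t = V' := by
  ext i j
  exact (hasDerivAt_iff_entries.1 h i j).deriv

lemma hasDerivAt_adjugate {V : ℝ → Mat} {V' : Mat} {t : ℝ} (h : HasDerivAt V V' t) :
    HasDerivAt (fun s => (V s).adjugate) V'.adjugate t := by
  rw [hasDerivAt_iff_entries] at h ⊢
  intro i j
  fin_cases i <;> fin_cases j <;>
    simp only [Matrix.adjugate_fin_two, Fin.zero_eta, Fin.mk_one, Matrix.of_apply,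
      Matrix.cons_val', Matrix.cons_val_zero, Matrix.cons_val_one, Matrix.cons_val_fin_one]
  exacts [h 1 1, (h 0 1).neg, (h 1 0).neg, h 0 0]

lemma hasDerivAt_trace {V : ℝ → Mat} {V' : Mat} {t : ℝ} (h : HasDerivAt V V' t) :
    HasDerivAt (fun s => (V s).trace) V'.trace t := by
  simp only [Matrix.trace_fin_two]
  rw [hasDerivAt_iff_entries] at h
  exact (h 0 0).add (h 1 1)

lemma IsSmooth.hasDerivAt_velocity {γ : Curve} (h : IsSmooth γ) (t : ℝ) :
    HasDerivAt (fun s => (γ s : Mat)) (velocity γ t) t :=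
  hasDerivAt_iff_entries.2 fun i j => ((h i j).differentiable (by simp) t).hasDerivAt

lemma coe_inv_mul_self (A : SL(2, ℝ)) : ((A⁻¹ : SL(2, ℝ)) : Mat) * (A : Mat) = 1 := by
  rw [← Matrix.SpecialLinearGroup.coe_mul, inv_mul_cancel, Matrix.SpecialLinearGroup.coe_one]

lemma coe_mul_inv_self (A : SL(2, ℝ)) : (A : Mat) * ((A⁻¹ : SL(2, ℝ)) : Mat) = 1 := by
  rw [← Matrix.SpecialLinearGroup.coe_mul, mul_inv_cancel, Matrix.SpecialLinearGroup.coe_one]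

end MatrixCalculus

section HillFrames

/-- The potential `w (0, 1; κ, 0)` of the linear system `Γ' = Γ X`, which for `w = 1` is Hill's
equation `u'' = κ u` for the second column entries of `Γ`. -/
def hillMatrix (κ w : ℝ) : Mat := w • !![0, 1; κ, 0]

/-- The transition matrix from a frame `Γ₀` to a frame `Γ`. -/
def transition (Γ₀ Γ : Curve) (t : ℝ) : Mat := (((Γ₀ t)⁻¹ : SL(2, ℝ)) : Mat) * Γ t

/-- A Hill frame: a fundamental solution, in `SL(2, ℝ)`, of the Hill system with potential `κ` and
arc element `w`. -/
def IsHillFrame (Γ : Curve) (κ w : ℝ → ℝ) : Prop :=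
  ∀ t, HasDerivAt (fun s => (Γ s : Mat)) (Γ t * hillMatrix (κ t) (w t)) t

lemma adjugate_hillMatrix (κ w : ℝ) : (hillMatrix κ w).adjugate = -hillMatrix κ w := by
  ext i j
  fin_cases i <;> fin_cases j <;> simp [hillMatrix, Matrix.adjugate_fin_two]

lemma mul_hillMatrix (A : Mat) (κ w : ℝ) :
    A * hillMatrix κ w = !![w * κ * A 0 1, w * A 0 0; w * κ * A 1 1, w * A 1 0] := by
  ext i j
  fin_cases i <;> fin_cases j <;> simp [hillMatrix, Matrix.mul_apply] <;> ring

lemma hillMatrix_mul (A : Mat) (κ w : ℝ) :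
    hillMatrix κ w * A = !![w * A 1 0, w * A 1 1; w * κ * A 0 0, w * κ * A 0 1] := by
  ext i j
  fin_cases i <;> fin_cases j <;> simp [hillMatrix, Matrix.mul_apply, mul_assoc]

lemma isHillFrame_of_leftVelocity {Γ : Curve} {κ w : ℝ → ℝ} (hs : IsSmooth Γ)
    (h : ∀ t, leftVelocity Γ t = hillMatrix (κ t) (w t)) : IsHillFrame Γ κ w := by
  intro t
  rw [← h, leftVelocity, ← Matrix.mul_assoc, coe_mul_inv_self, Matrix.one_mul]
  exact hs.hasDerivAt_velocity t

namespace IsHillFrame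

variable {Γ Γ₀ : Curve} {κ κ₀ w w₀ : ℝ → ℝ} {t : ℝ}

lemma leftVelocity_eq (h : IsHillFrame Γ κ w) (t : ℝ) :
    leftVelocity Γ t = hillMatrix (κ t) (w t) := by
  rw [leftVelocity, velocity, mderiv_eq (h t), ← Matrix.mul_assoc, coe_inv_mul_self,
    Matrix.one_mul]

lemma hasDerivAt_inv (h : IsHillFrame Γ κ w) (t : ℝ) :
    HasDerivAt (fun s => (((Γ s)⁻¹ : SL(2, ℝ)) : Mat))
      (-(hillMatrix (κ t) (w t) * ((Γ t)⁻¹ : SL(2, ℝ)))) t := by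
  have hadj := hasDerivAt_adjugate (h t)
  rw [Matrix.adjugate_mul_distrib, adjugate_hillMatrix, Matrix.neg_mul] at hadj
  simpa only [Matrix.SpecialLinearGroup.coe_inv] using hadj

lemma hasDerivAt_transition (h₀ : IsHillFrame Γ₀ κ₀ w₀) (h : IsHillFrame Γ κ w) (t : ℝ) :
    HasDerivAt (transition Γ₀ Γ)
      (transition Γ₀ Γ t * hillMatrix (κ t) (w t) - hillMatrix (κ₀ t) (w₀ t) * transition Γ₀ Γ t)
      t :=
  ((h₀.hasDerivAt_inv t).mul (h t)).congr_deriv (by rw [transition]; noncomm_ring)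

lemma hasDerivAt_conj (h : IsHillFrame Γ κ w) {V : ℝ → Mat} {V' : Mat} (hV : HasDerivAt V V' t) :
    HasDerivAt (fun s => (Γ s : Mat) * V s * ((Γ s)⁻¹ : SL(2, ℝ)))
      (Γ t * (V' + ⁅hillMatrix (κ t) (w t), V t⁆) * ((Γ t)⁻¹ : SL(2, ℝ))) t :=
  (((h t).mul hV).mul (h.hasDerivAt_inv t)).congr_deriv (by
    simp only [Ring.lie_def, Pi.mul_apply]
    noncomm_ring)

end IsHillFrame

end HillFrames

section SpinorFrames

lemma IsSmooth.mul {Γ Γ' : Curve} (h : IsSmooth Γ) (h' : IsSmooth Γ') :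
    IsSmooth fun t => Γ t * Γ' t := by
  intro i j
  simp only [Matrix.SpecialLinearGroup.coe_mul, Matrix.mul_apply]
  exact ContDiff.sum fun l _ => (h i l).mul (h' l j)

lemma IsSmooth.inv {Γ : Curve} (h : IsSmooth Γ) : IsSmooth fun t => (Γ t)⁻¹ := by
  intro i j
  simp only [Matrix.SpecialLinearGroup.coe_inv, Matrix.adjugate_fin_two]
  fin_cases i <;> fin_cases j
  exacts [h 1 1, (h 0 1).neg, (h 1 0).neg, h 0 0]

lemma eq_zero_of_mul_mul_inv_eq_zero {A B : SL(2, ℝ)} {X : Mat}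
    (h : (A : Mat) * X * (B⁻¹ : SL(2, ℝ)) = 0) : X = 0 := by
  calc X = (A⁻¹ : SL(2, ℝ)) * A * X * ((B⁻¹ : SL(2, ℝ)) * B) := by
        rw [coe_inv_mul_self, coe_inv_mul_self, Matrix.one_mul, Matrix.mul_one]
    _ = (A⁻¹ : SL(2, ℝ)) * (A * X * (B⁻¹ : SL(2, ℝ))) * B := by simp only [Matrix.mul_assoc]
    _ = 0 := by rw [h, Matrix.mul_zero, Matrix.zero_mul]

/-- The nilpotent direction of a null curve without flex points, read in its spinor frame. -/
def nullMatrix : Mat := !![0, 0; 1, 0]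

lemma hillMatrix_add_one_sub (k w : ℝ) :
    hillMatrix (k + 1) w - hillMatrix (k - 1) w = (2 * w) • nullMatrix := by
  ext i j
  fin_cases i <;> fin_cases j <;> simp [hillMatrix, nullMatrix]
  ring

lemma lie_hillMatrix_nullMatrix (κ w a : ℝ) :
    ⁅hillMatrix κ w, a • nullMatrix⁆ = (w * a) • !![1, 0; 0, -1] := by
  rw [Ring.lie_def]
  ext i j
  fin_cases i <;> fin_cases j <;> simp [hillMatrix, nullMatrix]
  ring

namespace IsSpinorFrame

variable {γ Γp Γm : Curve} {k w : ℝ → ℝ}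

lemma isHillFrame_plus (h : IsSpinorFrame γ Γp Γm k w) : IsHillFrame Γp (fun t => k t + 1) w :=
  isHillFrame_of_leftVelocity h.smooth_plus h.plus

lemma isHillFrame_minus (h : IsSpinorFrame γ Γp Γm k w) : IsHillFrame Γm (fun t => k t - 1) w :=
  isHillFrame_of_leftVelocity h.smooth_minus h.minus

lemma isSmooth (h : IsSpinorFrame γ Γp Γm k w) : IsSmooth γ := by
  rw [funext h.lift]
  exact h.smooth_plus.mul h.smooth_minus.inv

lemma velocity_eq (h : IsSpinorFrame γ Γp Γm k w) (t : ℝ) :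
    velocity γ t = Γp t * ((2 * w t) • nullMatrix) * ((Γm t)⁻¹ : SL(2, ℝ)) := by
  rw [← hillMatrix_add_one_sub (k t)]
  refine mderiv_eq ?_
  simp only [h.lift, Matrix.SpecialLinearGroup.coe_mul]
  exact ((h.isHillFrame_plus t).mul (h.isHillFrame_minus.hasDerivAt_inv t)).congr_deriv
    (by noncomm_ring)

lemma leftVelocity_eq (h : IsSpinorFrame γ Γp Γm k w) (t : ℝ) :
    leftVelocity γ t = Γm t * ((2 * w t) • nullMatrix) * ((Γm t)⁻¹ : SL(2, ℝ)) := by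
  rw [leftVelocity, h.velocity_eq, h.lift, mul_inv_rev, inv_inv,
    Matrix.SpecialLinearGroup.coe_mul]
  simp only [Matrix.mul_assoc]
  rw [← Matrix.mul_assoc (((Γp t)⁻¹ : SL(2, ℝ)) : Mat), coe_inv_mul_self, Matrix.one_mul]

lemma isNullCurve (h : IsSpinorFrame γ Γp Γm k w) : IsNullCurve γ := by
  refine ⟨h.isSmooth, fun t => ?_⟩
  rw [h.leftVelocity_eq, Matrix.det_mul, Matrix.det_mul, Matrix.det_smul]
  simp [nullMatrix, Matrix.det_fin_two]

lemma covDeriv_velocity (h : IsSpinorFrame γ Γp Γm k w) (t : ℝ) :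
    covDeriv γ (velocity γ) t =
      (Γp t : Mat) * ((2 * deriv w t) • nullMatrix + (w t * (2 * w t)) • !![1, 0; 0, -1]) *
        (((Γm t)⁻¹ : SL(2, ℝ)) : Mat) := by
  have hw : HasDerivAt (fun s => (2 * w s) • nullMatrix) ((2 * deriv w t) • nullMatrix) t :=
    ((h.smooth_arc.differentiable (by simp) t).hasDerivAt.const_mul 2).smul_const _
  have hleft : mderiv (leftVelocity γ) t =
      (Γm t : Mat) * ((2 * deriv w t) • nullMatrix + (w t * (2 * w t)) • !![1, 0; 0, -1]) *
        (((Γm t)⁻¹ : SL(2, ℝ)) : Mat) := by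
    rw [funext h.leftVelocity_eq, ← lie_hillMatrix_nullMatrix (k t - 1)]
    exact mderiv_eq (h.isHillFrame_minus.hasDerivAt_conj hw)
  change (γ t : Mat) * (mderiv (leftVelocity γ) t +
    (1 / 2 : ℝ) • ⁅leftVelocity γ t, leftVelocity γ t⁆) = _
  rw [hleft, Ring.lie_def, sub_self, smul_zero, add_zero, h.lift, Matrix.SpecialLinearGroup.coe_mul]
  simp only [Matrix.mul_assoc]
  rw [← Matrix.mul_assoc (((Γm t)⁻¹ : SL(2, ℝ)) : Mat) (Γm t : Mat), coe_inv_mul_self,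
    Matrix.one_mul]

lemma noFlex (h : IsSpinorFrame γ Γp Γm k w) : NoFlex γ := by
  intro t
  rw [LinearIndependent.pair_iff, h.velocity_eq, h.covDeriv_velocity]
  intro a b hab
  have hzero : a • (2 * w t) • nullMatrix +
      b • ((2 * deriv w t) • nullMatrix + (w t * (2 * w t)) • !![1, 0; 0, -1]) = 0 := by
    refine eq_zero_of_mul_mul_inv_eq_zero (A := Γp t) (B := Γm t) ?_
    simpa only [Matrix.mul_add, Matrix.add_mul, Matrix.mul_smul, Matrix.smul_mul] using hab
  have hw := h.arc_ne_zero t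
  have hb : b = 0 := by simpa [nullMatrix, hw] using congrFun₂ hzero 0 0
  exact ⟨by simpa [nullMatrix, hw, hb] using congrFun₂ hzero 1 0, hb⟩

end IsSpinorFrame

end SpinorFrames

section Uniqueness

lemma eq_zero_of_hasDerivAt_of_eqOn_const {f : ℝ → ℝ} {U : Set ℝ} {c d t : ℝ} (hU : IsOpen U)
    (ht : t ∈ U) (hf : ∀ s ∈ U, f s = c) (hd : HasDerivAt f d t) : d = 0 :=
  (hd.congr_of_eventuallyEq (f₁ := fun _ => c) <| by
    filter_upwards [hU.mem_nhds ht] with s hs using (hf s hs).symm).unique (hasDerivAt_const t c)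

lemma det_transition (Γ₀ Γ : Curve) (t : ℝ) :
    transition Γ₀ Γ t 0 0 * transition Γ₀ Γ t 1 1 -
      transition Γ₀ Γ t 0 1 * transition Γ₀ Γ t 1 0 = 1 := by
  rw [← Matrix.det_fin_two, transition, Matrix.det_mul, Matrix.SpecialLinearGroup.det_coe,
    Matrix.SpecialLinearGroup.det_coe, mul_one]

namespace IsSpinorFrame

variable {γ γ' Γp Γm Γp' Γm' : Curve} {k w k' w' : ℝ → ℝ} {U : Set ℝ} {t : ℝ}

lemma transition_plus_eq_minus (h : IsSpinorFrame γ Γp Γm k w)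
    (h' : IsSpinorFrame γ' Γp' Γm' k' w') (ht : γ t = γ' t) :
    transition Γp Γp' t = transition Γm Γm' t := by
  rw [h.lift, h'.lift, mul_inv_eq_iff_eq_mul] at ht
  simp only [transition, ← Matrix.SpecialLinearGroup.coe_mul, ht]
  group

/-- Both transition matrices coincide, and comparing their differential equations leaves only the
difference of the two potentials, which is a multiple of `nullMatrix`. -/
lemma transition_mul_nullMatrix (h : IsSpinorFrame γ Γp Γm k w)
    (h' : IsSpinorFrame γ' Γp' Γm' k' w') (hU : IsOpen U) (hγ : ∀ s ∈ U, γ s = γ' s)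
    (ht : t ∈ U) :
    transition Γp Γp' t * ((2 * w' t) • nullMatrix) =
      ((2 * w t) • nullMatrix) * transition Γp Γp' t := by
  have hplus := h.isHillFrame_plus.hasDerivAt_transition h'.isHillFrame_plus t
  have hminus := (h.isHillFrame_minus.hasDerivAt_transition h'.isHillFrame_minus t)
    |>.congr_of_eventuallyEq <| by
      filter_upwards [hU.mem_nhds ht] with s hs using h.transition_plus_eq_minus h' (hγ s hs)
  have heq := hplus.unique hminus
  rw [← h.transition_plus_eq_minus h' (hγ t ht), sub_eq_sub_iff_sub_eq_sub, ← Matrix.mul_sub,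
    ← Matrix.sub_mul] at heq
  simpa only [hillMatrix_add_one_sub] using heq

lemma transition_lower (h : IsSpinorFrame γ Γp Γm k w)
    (h' : IsSpinorFrame γ' Γp' Γm' k' w') (hU : IsOpen U) (hγ : ∀ s ∈ U, γ s = γ' s)
    (ht : t ∈ U) :
    transition Γp Γp' t 0 1 = 0 ∧
      transition Γp Γp' t 1 1 * w' t = w t * transition Γp Γp' t 0 0 := by
  have hnull := h.transition_mul_nullMatrix h' hU hγ ht
  have h10 : transition Γp Γp' t 1 1 * (2 * w' t) = 2 * w t * transition Γp Γp' t 0 0 := by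
    simpa [nullMatrix, Matrix.mul_apply] using congrFun₂ hnull 1 0
  exact ⟨by simpa [nullMatrix, Matrix.mul_apply, h'.arc_ne_zero] using congrFun₂ hnull 0 0,
    by linarith⟩

lemma transition_diagonal (h : IsSpinorFrame γ Γp Γm k w)
    (h' : IsSpinorFrame γ' Γp' Γm' k' w') (hU : IsOpen U) (hγ : ∀ s ∈ U, γ s = γ' s)
    (ht : t ∈ U) :
    transition Γp Γp' t 0 0 ^ 2 = 1 ∧ transition Γp Γp' t 1 1 = transition Γp Γp' t 0 0 ∧
      w t = w' t := by
  obtain ⟨h01, hlower⟩ := h.transition_lower h' hU hγ ht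
  have hd := hasDerivAt_iff_entries.1
    (h.isHillFrame_plus.hasDerivAt_transition h'.isHillFrame_plus t) 0 1
  have hzero : w' t * transition Γp Γp' t 0 0 - w t * transition Γp Γp' t 1 1 = 0 := by
    simpa [mul_hillMatrix, hillMatrix_mul] using eq_zero_of_hasDerivAt_of_eqOn_const hU ht
      (fun s hs => (h.transition_lower h' hU hγ hs).1) hd
  have hdet : transition Γp Γp' t 0 0 * transition Γp Γp' t 1 1 = 1 := by
    simpa only [h01, zero_mul, sub_zero] using det_transition Γp Γp' t
  set a := transition Γp Γp' t 0 0
  set d := transition Γp Γp' t 1 1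
  have hw := h.arc_ne_zero t
  have hsq_arc : w t * a ^ 2 = w' t := by linear_combination w' t * hdet - a * hlower
  have hsq_arc' : w' t * a ^ 2 = w t := by linear_combination a * hzero + w t * hdet
  have hfourth : (a ^ 2) ^ 2 = 1 :=
    mul_left_cancel₀ hw (by linear_combination a ^ 2 * hsq_arc + hsq_arc')
  have hsq : a ^ 2 = 1 := by nlinarith [sq_nonneg a]
  exact ⟨hsq, by linear_combination a * hdet - d * hsq, by rw [← hsq_arc, hsq, mul_one]⟩

lemma transition_one_zero (h : IsSpinorFrame γ Γp Γm k w)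
    (h' : IsSpinorFrame γ' Γp' Γm' k' w') (hU : IsOpen U) (hγ : ∀ s ∈ U, γ s = γ' s)
    (ht : t ∈ U) : transition Γp Γp' t 1 0 = 0 := by
  have hd := (hasDerivAt_iff_entries.1
    (h.isHillFrame_plus.hasDerivAt_transition h'.isHillFrame_plus t) 0 0).pow 2
  have hzero := eq_zero_of_hasDerivAt_of_eqOn_const hU ht
    (fun s hs => (h.transition_diagonal h' hU hγ hs).1) hd
  have hne : transition Γp Γp' t 0 0 ≠ 0 := fun h0 => by
    simpa [h0] using (h.transition_diagonal h' hU hγ ht).1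
  simpa [mul_hillMatrix, hillMatrix_mul, (h.transition_lower h' hU hγ ht).1, hne,
    h.arc_ne_zero t] using hzero

lemma exists_transition_eq_smul_one (h : IsSpinorFrame γ Γp Γm k w)
    (h' : IsSpinorFrame γ' Γp' Γm' k' w') (hU : IsOpen U) (hγ : ∀ s ∈ U, γ s = γ' s)
    (ht : t ∈ U) :
    ∃ e : ℝ, transition Γp Γp' t = e • 1 ∧ transition Γm Γm' t = e • 1 := by
  have hplus : transition Γp Γp' t = transition Γp Γp' t 0 0 • 1 := by
    ext i j
    fin_cases i <;> fin_cases j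
    · simp
    · simpa using (h.transition_lower h' hU hγ ht).1
    · simpa using h.transition_one_zero h' hU hγ ht
    · simpa using (h.transition_diagonal h' hU hγ ht).2.1
  exact ⟨_, hplus, (h.transition_plus_eq_minus h' (hγ t ht)).symm.trans hplus⟩

lemma curvature_eq (h : IsSpinorFrame γ Γp Γm k w)
    (h' : IsSpinorFrame γ' Γp' Γm' k' w') (hU : IsOpen U) (hγ : ∀ s ∈ U, γ s = γ' s)
    (ht : t ∈ U) : k t = k' t := by
  have hd := hasDerivAt_iff_entries.1
    (h.isHillFrame_plus.hasDerivAt_transition h'.isHillFrame_plus t) 1 0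
  obtain ⟨hsq, hdiag, harc⟩ := h.transition_diagonal h' hU hγ ht
  have hzero : w t * (k' t + 1) * transition Γp Γp' t 0 0 -
      w t * (k t + 1) * transition Γp Γp' t 0 0 = 0 := by
    simpa [mul_hillMatrix, hillMatrix_mul, hdiag, ← harc] using
      eq_zero_of_hasDerivAt_of_eqOn_const hU ht (fun s hs => h.transition_one_zero h' hU hγ hs) hd
  have hne : w t * transition Γp Γp' t 0 0 ≠ 0 :=
    mul_ne_zero (h.arc_ne_zero t) fun h0 => by simp [h0] at hsq
  exact mul_left_cancel₀ hne (by linear_combination -hzero)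

end IsSpinorFrame

end Uniqueness

section FirstVariation

variable {a b : ℝ}

lemma exists_norm_le_mul_of_vanish {E : Type*} [NormedAddCommGroup E] [NormedSpace ℝ E]
    {U : ℝ × ℝ → E} (hU : ContDiff ℝ 1 U) (h0 : ∀ t, U (0, t) = 0) (a b : ℝ) :
    ∃ C, ∀ ε ∈ Set.Icc (-1 : ℝ) 1, ∀ t ∈ Set.Icc a b, ‖U (ε, t)‖ ≤ C * |ε| := by
  have hc : IsCompact (Set.Icc (-1 : ℝ) 1 ×ˢ Set.Icc a b) := isCompact_Icc.prod isCompact_Icc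
  obtain ⟨K, hK⟩ := hU.locallyLipschitz.locallyLipschitzOn.exists_lipschitzOnWith_of_compact hc
  refine ⟨K, fun ε hε t ht => ?_⟩
  have hdist := hK.dist_le_mul (ε, t) ⟨hε, ht⟩ (0, t) ⟨by norm_num, ht⟩
  rw [h0, dist_zero_right] at hdist
  simpa [Prod.dist_eq] using hdist

lemma hasDerivAt_integral_mul_of_vanish {A : Type*} [NormedRing A] [NormedAlgebra ℝ A]
    (L : A →L[ℝ] ℝ) {U V : ℝ × ℝ → A} (hU : ContDiff ℝ 1 U) (hV : ContDiff ℝ 1 V)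
    (hU0 : ∀ t, U (0, t) = 0) (hV0 : ∀ t, V (0, t) = 0) (hab : a ≤ b) :
    HasDerivAt (fun ε => ∫ t in a..b, L (U (ε, t) * V (ε, t))) 0 0 := by
  obtain ⟨C, hC⟩ := exists_norm_le_mul_of_vanish hU hU0 a b
  obtain ⟨D, hD⟩ := exists_norm_le_mul_of_vanish hV hV0 a b
  have hO : (fun ε => ∫ t in a..b, L (U (ε, t) * V (ε, t))) =O[nhds 0] fun ε => ‖ε - 0‖ ^ 2 := by
    refine Asymptotics.IsBigO.of_bound (‖L‖ * (C * D) * |b - a|) ?_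
    filter_upwards [Icc_mem_nhds (show (-1 : ℝ) < 0 by norm_num) one_pos] with ε hε
    have hbound : ∀ t ∈ Set.uIoc a b,
        ‖L (U (ε, t) * V (ε, t))‖ ≤ ‖L‖ * (C * |ε| * (D * |ε|)) := by
      intro t ht
      have ht' : t ∈ Set.Icc a b := Set.Ioc_subset_Icc_self (Set.uIoc_of_le hab ▸ ht)
      refine (L.le_opNorm _).trans (mul_le_mul_of_nonneg_left ?_ (norm_nonneg L))
      exact (norm_mul_le _ _).trans (mul_le_mul (hC ε hε t ht') (hD ε hε t ht') (norm_nonneg _)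
        ((norm_nonneg _).trans (hC ε hε t ht')))
    refine (intervalIntegral.norm_integral_le_of_norm_le_const hbound).trans_eq ?_
    simp only [Real.norm_eq_abs, sub_zero, abs_pow, abs_abs]
    ring
  simpa using (hO.hasFDerivAt (by norm_num)).hasDerivAt

/-- The trace, as a continuous linear functional. -/
noncomputable def traceCLM : Mat →L[ℝ] ℝ :=
  (Matrix.traceLinearMap (Fin 2) ℝ ℝ).toContinuousLinearMap

lemma traceCLM_apply (A : Mat) : traceCLM A = A.trace := rfl

lemma contDiff_of_entries {E : Type*} [NormedAddCommGroup E] [NormedSpace ℝ E] {n : WithTop ℕ∞}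
    {V : E → Mat} (hV : ∀ i j, ContDiff ℝ n fun x => V x i j) : ContDiff ℝ n V := by
  have hsum : V = fun x => ∑ i, ∑ j, V x i j • (Matrix.single i j 1 : Mat) := by
    funext x
    simpa only [Matrix.smul_single, smul_eq_mul, mul_one] using Matrix.matrix_eq_sum_single (V x)
  rw [hsum]
  exact ContDiff.sum fun i _ => ContDiff.sum fun j _ => (hV i j).smul contDiff_const

lemma contDiff_hillMatrix {E : Type*} [NormedAddCommGroup E] [NormedSpace ℝ E] {n : WithTop ℕ∞}
    {κ w : E → ℝ} (hκ : ContDiff ℝ n κ) (hw : ContDiff ℝ n w) :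
    ContDiff ℝ n fun x => hillMatrix (κ x) (w x) := by
  refine contDiff_of_entries fun i j => ?_
  fin_cases i <;> fin_cases j
  · simpa [hillMatrix] using contDiff_const
  · simpa [hillMatrix] using hw
  · simpa [hillMatrix] using hw.mul hκ
  · simpa [hillMatrix] using contDiff_const

lemma IsSmoothFamily.contDiff_transition {Γ : ℝ → Curve} (hΓ : IsSmoothFamily Γ) :
    ContDiff ℝ ∞ fun p : ℝ × ℝ => transition (Γ 0) (Γ p.1) p.2 := by
  have h0 : ∀ i j, ContDiff ℝ ∞ fun p : ℝ × ℝ => (Γ 0 p.2 : Mat) i j := fun i j =>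
    (hΓ i j).comp (contDiff_const.prodMk contDiff_snd)
  refine (contDiff_of_entries fun i j => ?_).mul (contDiff_of_entries hΓ)
  simp only [Matrix.SpecialLinearGroup.coe_inv, Matrix.adjugate_fin_two]
  fin_cases i <;> fin_cases j
  exacts [h0 1 1, (h0 0 1).neg, (h0 1 0).neg, h0 0 0]

namespace IsHillFrame

variable {Γ₀ Γ : Curve} {κ₀ w₀ κ w : ℝ → ℝ} {M : ℝ → Mat}

/-- A momentum `M` of the frame `Γ₀`, that is a solution of `M' = [M, X₀]`, is a constant matrix
conjugated by `Γ₀`; the term `X₀` of the derivative of the transition matrix is thus absorbed. -/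
lemma hasDerivAt_trace_mul_transition {t : ℝ} (h₀ : IsHillFrame Γ₀ κ₀ w₀)
    (h : IsHillFrame Γ κ w) (hM : HasDerivAt M ⁅M t, hillMatrix (κ₀ t) (w₀ t)⁆ t) :
    HasDerivAt (fun s => (M s * transition Γ₀ Γ s).trace)
      (M t * transition Γ₀ Γ t *
        (hillMatrix (κ t) (w t) - hillMatrix (κ₀ t) (w₀ t))).trace t := by
  refine (hasDerivAt_trace (hM.mul (h₀.hasDerivAt_transition h t))).congr_deriv ?_
  have hcycle := Matrix.trace_mul_comm (hillMatrix (κ₀ t) (w₀ t)) (M t * transition Γ₀ Γ t)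
  simp only [Ring.lie_def, Matrix.sub_mul, Matrix.mul_sub, Matrix.trace_add, Matrix.trace_sub,
    Matrix.mul_assoc] at hcycle ⊢
  linarith

lemma continuous_transition (h₀ : IsHillFrame Γ₀ κ₀ w₀) (h : IsHillFrame Γ κ w) :
    Continuous (transition Γ₀ Γ) :=
  continuous_iff_continuousAt.2 fun t => (h₀.hasDerivAt_transition h t).continuousAt

lemma integral_trace_eq_zero (h₀ : IsHillFrame Γ₀ κ₀ w₀) (h : IsHillFrame Γ κ w)
    (hX : Continuous fun t => hillMatrix (κ t) (w t) - hillMatrix (κ₀ t) (w₀ t))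
    (hM : ∀ t, HasDerivAt M ⁅M t, hillMatrix (κ₀ t) (w₀ t)⁆ t) (hM0 : ∀ t, (M t).trace = 0)
    (ha : ∃ e : ℝ, transition Γ₀ Γ a = e • 1) (hb : ∃ e : ℝ, transition Γ₀ Γ b = e • 1) :
    ∫ t in a..b, (M t * transition Γ₀ Γ t *
      (hillMatrix (κ t) (w t) - hillMatrix (κ₀ t) (w₀ t))).trace = 0 := by
  have hMc : Continuous M := continuous_iff_continuousAt.2 fun t => (hM t).continuousAt
  have hSc := h₀.continuous_transition h
  obtain ⟨e, he⟩ := ha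
  obtain ⟨e', he'⟩ := hb
  rw [intervalIntegral.integral_eq_sub_of_hasDerivAt
    (fun t _ => h₀.hasDerivAt_trace_mul_transition h (hM t))
    ((traceCLM.continuous.comp ((hMc.mul hSc).mul hX)).intervalIntegrable a b)]
  simp [he, he', hM0]

lemma integral_trace_mul_one_sub_transition (h₀ : IsHillFrame Γ₀ κ₀ w₀) (h : IsHillFrame Γ κ w)
    (hX : Continuous fun t => hillMatrix (κ t) (w t) - hillMatrix (κ₀ t) (w₀ t))
    (hM : ∀ t, HasDerivAt M ⁅M t, hillMatrix (κ₀ t) (w₀ t)⁆ t) (hM0 : ∀ t, (M t).trace = 0)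
    (ha : ∃ e : ℝ, transition Γ₀ Γ a = e • 1) (hb : ∃ e : ℝ, transition Γ₀ Γ b = e • 1) :
    ∫ t in a..b, (M t * (1 - transition Γ₀ Γ t) *
        (hillMatrix (κ t) (w t) - hillMatrix (κ₀ t) (w₀ t))).trace =
      ∫ t in a..b, (M t * (hillMatrix (κ t) (w t) - hillMatrix (κ₀ t) (w₀ t))).trace := by
  have hMc : Continuous M := continuous_iff_continuousAt.2 fun t => (hM t).continuousAt
  have hSc := h₀.continuous_transition h
  have hsub := intervalIntegral.integral_sub (μ := MeasureTheory.volume)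
    ((traceCLM.continuous.comp (hMc.mul hX)).intervalIntegrable a b)
    ((traceCLM.continuous.comp ((hMc.mul hSc).mul hX)).intervalIntegrable a b)
  simp only [Function.comp_apply, Pi.mul_apply, traceCLM_apply,
    h₀.integral_trace_eq_zero h hX hM hM0 ha hb, sub_zero] at hsub
  refine (intervalIntegral.integral_congr fun t _ => ?_).trans hsub
  simp only [Matrix.mul_sub, Matrix.mul_one, Matrix.sub_mul, Matrix.trace_sub]
  ring

end IsHillFrame

/-- To first order the transition matrix may be replaced by the identity in
`IsHillFrame.integral_trace_eq_zero`, because both `1 - S` and `X - X₀` vanish at `ε = 0`. -/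
lemma hasDerivAt_integral_trace_mul_hillMatrix {Γ : ℝ → Curve} {κ w : ℝ → ℝ → ℝ} {M : ℝ → Mat}
    (hab : a ≤ b) (hΓ : IsSmoothFamily Γ) (hκ : ContDiff ℝ ∞ fun p : ℝ × ℝ => κ p.1 p.2)
    (hw : ContDiff ℝ ∞ fun p : ℝ × ℝ => w p.1 p.2) (h : ∀ ε, IsHillFrame (Γ ε) (κ ε) (w ε))
    (hMs : ContDiff ℝ ∞ M) (hM : ∀ t, HasDerivAt M ⁅M t, hillMatrix (κ 0 t) (w 0 t)⁆ t)
    (hM0 : ∀ t, (M t).trace = 0) (ha : ∀ ε, ∃ e : ℝ, transition (Γ 0) (Γ ε) a = e • 1)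
    (hb : ∀ ε, ∃ e : ℝ, transition (Γ 0) (Γ ε) b = e • 1) :
    HasDerivAt (fun ε => ∫ t in a..b,
      (M t * (hillMatrix (κ ε t) (w ε t) - hillMatrix (κ 0 t) (w 0 t))).trace) 0 0 := by
  have hS := hΓ.contDiff_transition
  have hMs' : ContDiff ℝ ∞ fun p : ℝ × ℝ => M p.2 := hMs.comp contDiff_snd
  have hX : ContDiff ℝ ∞ fun p : ℝ × ℝ =>
      hillMatrix (κ p.1 p.2) (w p.1 p.2) - hillMatrix (κ 0 p.2) (w 0 p.2) :=
    (contDiff_hillMatrix hκ hw).sub (contDiff_hillMatrix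
      (hκ.comp (contDiff_const.prodMk contDiff_snd)) (hw.comp (contDiff_const.prodMk contDiff_snd)))
  have hone : ∀ t, transition (Γ 0) (Γ 0) t = 1 := fun t => coe_inv_mul_self _
  have hsecond := hasDerivAt_integral_mul_of_vanish traceCLM
    (U := fun p => M p.2 * (1 - transition (Γ 0) (Γ p.1) p.2))
    ((hMs'.mul (contDiff_const.sub hS)).of_le (by simp)) (hX.of_le (by simp))
    (fun t => by simp only [hone, sub_self, mul_zero]) (fun t => sub_self _) hab
  exact hsecond.congr_of_eventuallyEq <| Filter.Eventually.of_forall fun ε =>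
    ((h 0).integral_trace_mul_one_sub_transition (h ε)
      (hX.continuous.comp (Continuous.prodMk_right ε)) hM hM0 (ha ε) (hb ε)).symm

end FirstVariation

section Criticality

lemma IsSpinorFrame.exists_transition_eq_smul_one_of_mem_closure {γ γ' Γp Γm Γp' Γm' : Curve}
    {k w k' w' : ℝ → ℝ} {U : Set ℝ} {t : ℝ} (h : IsSpinorFrame γ Γp Γm k w)
    (h' : IsSpinorFrame γ' Γp' Γm' k' w') (hU : IsOpen U) (hγ : ∀ s ∈ U, γ s = γ' s)
    (ht : t ∈ closure U) :
    ∃ e : ℝ, transition Γp Γp' t = e • 1 ∧ transition Γm Γm' t = e • 1 := by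
  have hplus := h.isHillFrame_plus.continuous_transition h'.isHillFrame_plus
  have hminus := h.isHillFrame_minus.continuous_transition h'.isHillFrame_minus
  have hscalar : Continuous fun s => transition Γp Γp' s 0 0 • (1 : Mat) :=
    (hplus.matrix_elem 0 0).smul continuous_const
  have hclosed : IsClosed {s | transition Γp Γp' s = transition Γp Γp' s 0 0 • 1 ∧
      transition Γm Γm' s = transition Γp Γp' s 0 0 • 1} :=
    (isClosed_eq hplus hscalar).inter (isClosed_eq hminus hscalar)
  refine ⟨_, closure_minimal (fun s hs => ?_) hclosed ht⟩
  obtain ⟨e, he⟩ := h.exists_transition_eq_smul_one h' hU hγ hs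
  have hentry : transition Γp Γp' s 0 0 = e := by simp [he.1]
  simpa only [Set.mem_ofPred_eq, hentry] using he

lemma IsVariation.exists_transition_eq_smul_one {γ : Curve} {a b t : ℝ} {F Γp Γm : ℝ → Curve}
    {k w : ℝ → ℝ → ℝ} (hV : IsVariation γ a b F Γp Γm k w) (ε : ℝ) (ht : t ≤ a ∨ b ≤ t) :
    ∃ e : ℝ, transition (Γp 0) (Γp ε) t = e • 1 ∧ transition (Γm 0) (Γm ε) t = e • 1 := by
  refine (hV.frame 0).exists_transition_eq_smul_one_of_mem_closure (hV.frame ε)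
    (isClosed_Icc (a := a) (b := b)).isOpen_compl
    (fun s hs => (hV.support 0 s hs).trans (hV.support ε s hs).symm) ?_
  rcases ht with ht | ht
  · rw [← Set.mem_Iic, ← closure_Iio] at ht
    exact closure_mono (fun s hs (hs' : s ∈ Set.Icc a b) => not_le_of_gt hs hs'.1) ht
  · rw [← Set.mem_Ici, ← closure_Ioi] at ht
    exact closure_mono (fun s hs (hs' : s ∈ Set.Icc a b) => not_le_of_gt hs hs'.2) ht

/-- The momentum, in a Hill frame with potential `κ`, given by a product `y` of two solutions of
Hill's equation; `y₁` and `y₂` stand for the first two derivatives of `y`. -/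
noncomputable def momentum (κ y y₁ y₂ : ℝ) : Mat := !![y₁ / 2, y; y * κ - y₂ / 2, -y₁ / 2]

lemma trace_momentum (κ y y₁ y₂ : ℝ) : (momentum κ y y₁ y₂).trace = 0 := by
  simp only [momentum, Matrix.trace_fin_two_of]
  ring

lemma trace_momentum_mul_hillMatrix (κ y y₁ y₂ κ' w' : ℝ) :
    (momentum κ y y₁ y₂ * hillMatrix κ' w').trace = w' * (y * κ' + y * κ - y₂ / 2) := by
  simp only [mul_hillMatrix, momentum, Matrix.trace_fin_two_of, Matrix.of_apply, Matrix.cons_val',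
    Matrix.cons_val_zero, Matrix.cons_val_one, Matrix.cons_val_fin_one]
  ring

lemma hasDerivAt_momentum {κ y y₁ y₂ : ℝ → ℝ} {κ₁ t : ℝ} (hκ : HasDerivAt κ κ₁ t)
    (hy : HasDerivAt y (y₁ t) t) (hy₁ : HasDerivAt y₁ (y₂ t) t)
    (hy₂ : HasDerivAt y₂ (4 * κ t * y₁ t + 2 * κ₁ * y t) t) :
    HasDerivAt (fun s => momentum (κ s) (y s) (y₁ s) (y₂ s))
      ⁅momentum (κ t) (y t) (y₁ t) (y₂ t), hillMatrix (κ t) 1⁆ t := by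
  rw [hasDerivAt_iff_entries, Ring.lie_def, mul_hillMatrix, hillMatrix_mul]
  intro i j
  fin_cases i <;> fin_cases j <;>
    simp only [momentum, Fin.zero_eta, Fin.mk_one, Matrix.sub_apply, Matrix.of_apply,
      Matrix.cons_val', Matrix.cons_val_zero, Matrix.cons_val_one, Matrix.cons_val_fin_one]
  · exact (hy₁.div_const 2).congr_deriv (by ring)
  · exact hy.congr_deriv (by ring)
  · exact ((hy.mul hκ).sub (hy₂.div_const 2)).congr_deriv (by ring)
  · exact (hy₁.neg.div_const 2).congr_deriv (by ring)

lemma contDiff_momentum {κ y y₁ y₂ : ℝ → ℝ} (hκ : ContDiff ℝ ∞ κ) (hy : ContDiff ℝ ∞ y)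
    (hy₁ : ContDiff ℝ ∞ y₁) (hy₂ : ContDiff ℝ ∞ y₂) :
    ContDiff ℝ ∞ fun t => momentum (κ t) (y t) (y₁ t) (y₂ t) := by
  refine contDiff_of_entries fun i j => ?_
  fin_cases i <;> fin_cases j
  exacts [hy₁.div_const 2, hy, (hy.mul hκ).sub (hy₂.div_const 2), hy₁.neg.div_const 2]

/-- The momentum of an extremal of curvature `k` in the Hill frame with potential `k + σ`; the
Euler-Lagrange equation of the action is its conservation for `σ = 1` and `σ = -1`. -/
noncomputable def extremalMomentum (m σ k k₁ k₂ : ℝ) : Mat :=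
  momentum (k + σ) (m + 2 * σ - k) (-k₁) (-k₂)

lemma hasDerivAt_extremalMomentum {m : ℝ} (σ : ℝ) {k k₁ k₂ : ℝ → ℝ} {t : ℝ}
    (hk : HasDerivAt k (k₁ t) t) (hk₁ : HasDerivAt k₁ (k₂ t) t)
    (hk₂ : HasDerivAt k₂ (6 * k t * k₁ t - 2 * m * k₁ t) t) :
    HasDerivAt (fun s => extremalMomentum m σ (k s) (k₁ s) (k₂ s))
      ⁅extremalMomentum m σ (k t) (k₁ t) (k₂ t), hillMatrix (k t + σ) 1⁆ t :=
  hasDerivAt_momentum (y₁ := fun s => -k₁ s) (y₂ := fun s => -k₂ s) (hk.add_const σ)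
    (hk.const_sub _) hk₁.neg (hk₂.neg.congr_deriv (by ring))

lemma trace_extremalMomentum_mul_sub (m σ k k₁ k₂ k' w' : ℝ) :
    (extremalMomentum m σ k k₁ k₂ * (hillMatrix (k' + σ) w' - hillMatrix (k + σ) 1)).trace =
      w' * ((m + 2 * σ - k) * (k' + k + 2 * σ) + k₂ / 2) -
        ((m + 2 * σ - k) * (k + k + 2 * σ) + k₂ / 2) := by
  simp only [extremalMomentum, Matrix.mul_sub, Matrix.trace_sub, trace_momentum_mul_hillMatrix]
  ring

lemma IsVariation.hasDerivAt_integral_extremalMomentum {m σ : ℝ} {γ : Curve} {a b : ℝ}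
    {F Γp Γm Γ : ℝ → Curve} {k w : ℝ → ℝ → ℝ} {k₁ k₂ : ℝ → ℝ}
    (hV : IsVariation γ a b F Γp Γm k w) (hab : a ≤ b) (hw : ∀ t, w 0 t = 1)
    (hk₁s : ContDiff ℝ ∞ k₁) (hk₂s : ContDiff ℝ ∞ k₂)
    (hk : ∀ t, HasDerivAt (k 0) (k₁ t) t) (hk₁ : ∀ t, HasDerivAt k₁ (k₂ t) t)
    (hk₂ : ∀ t, HasDerivAt k₂ (6 * k 0 t * k₁ t - 2 * m * k₁ t) t)
    (hΓ : IsSmoothFamily Γ) (hframe : ∀ ε, IsHillFrame (Γ ε) (fun t => k ε t + σ) (w ε))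
    (hscalar : ∀ ε t, t ≤ a ∨ b ≤ t → ∃ e : ℝ, transition (Γ 0) (Γ ε) t = e • 1) :
    HasDerivAt (fun ε => ∫ t in a..b,
      (w ε t * ((m + 2 * σ - k 0 t) * (k ε t + k 0 t + 2 * σ) + k₂ t / 2) -
        ((m + 2 * σ - k 0 t) * (k 0 t + k 0 t + 2 * σ) + k₂ t / 2))) 0 0 := by
  have hks := (hV.frame 0).smooth_curvature
  have hmain := hasDerivAt_integral_trace_mul_hillMatrix
    (M := fun t => extremalMomentum m σ (k 0 t) (k₁ t) (k₂ t)) hab hΓ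
    (hV.smooth_curvature.add contDiff_const) hV.smooth_arc hframe
    (contDiff_momentum (hks.add contDiff_const) (contDiff_const.sub hks) hk₁s.neg hk₂s.neg)
    (fun t => by rw [hw]; exact hasDerivAt_extremalMomentum σ (hk t) (hk₁ t) (hk₂ t))
    (fun t => trace_momentum _ _ _ _) (fun ε => hscalar ε a (Or.inl le_rfl))
    (fun ε => hscalar ε b (Or.inr le_rfl))
  simpa only [hw, trace_extremalMomentum_mul_sub] using hmain

lemma IsSpinorFrame.isCritical {m : ℝ} {γ Γp Γm : Curve} {k k₁ k₂ : ℝ → ℝ}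
    (h : IsSpinorFrame γ Γp Γm k fun _ => 1)
    (hk₁s : ContDiff ℝ ∞ k₁) (hk₂s : ContDiff ℝ ∞ k₂)
    (hk : ∀ t, HasDerivAt k (k₁ t) t) (hk₁ : ∀ t, HasDerivAt k₁ (k₂ t) t)
    (hk₂ : ∀ t, HasDerivAt k₂ (6 * k t * k₁ t - 2 * m * k₁ t) t) : IsCritical m γ := by
  intro a b F Γp' Γm' k' w' hab hV
  have hγ : ∀ s ∈ Set.univ, γ s = F 0 s := fun s _ => by rw [hV.start]
  have hw : ∀ t, w' 0 t = 1 := fun t =>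
    (h.transition_diagonal (hV.frame 0) isOpen_univ hγ (Set.mem_univ t)).2.2.symm
  obtain rfl : k = k' 0 := funext fun t =>
    h.curvature_eq (hV.frame 0) isOpen_univ hγ (Set.mem_univ t)
  have hplus := hV.hasDerivAt_integral_extremalMomentum (m := m) hab.le hw hk₁s hk₂s hk hk₁
    hk₂ hV.smooth_plus (fun ε => (hV.frame ε).isHillFrame_plus)
    fun ε t ht => (hV.exists_transition_eq_smul_one ε ht).imp fun _ => And.left
  have hminus := hV.hasDerivAt_integral_extremalMomentum (m := m) hab.le hw hk₁s hk₂s hk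
    hk₁ hk₂ hV.smooth_minus (fun ε => (hV.frame ε).isHillFrame_minus)
    fun ε t ht => (hV.exists_transition_eq_smul_one ε ht).imp fun _ => And.right
  have hcont : ∀ ε, Continuous (k' ε) ∧ Continuous (w' ε) := fun ε =>
    ⟨(hV.frame ε).smooth_curvature.continuous, (hV.frame ε).smooth_arc.continuous⟩
  have hk₂c := hk₂s.continuous
  refine (((hplus.sub hminus).div_const 4).add_const (∫ t in a..b, (m + k' 0 t))).congr_deriv
    (by simp) |>.congr_of_eventuallyEq (Filter.Eventually.of_forall fun ε => ?_)
  obtain ⟨hkc, hwc⟩ := hcont ε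
  obtain ⟨hkc0, -⟩ := hcont 0
  simp only [Pi.sub_apply]
  rw [← intervalIntegral.integral_sub
    (Continuous.intervalIntegrable (by fun_prop) _ _)
    (Continuous.intervalIntegrable (by fun_prop) _ _), ← intervalIntegral.integral_div,
    ← intervalIntegral.integral_add (Continuous.intervalIntegrable (by fun_prop) _ _)
      (Continuous.intervalIntegrable (by fun_prop) _ _)]
  refine intervalIntegral.integral_congr fun t _ => ?_
  ring

end Criticality

section AmplitudeFrames

/-- The frame with rows `(f', f)` for the solutions `f = A sin θ` and `f = A cos θ` of Hill's
equation in amplitude-phase form: `A₁` stands for `A'`, and the Wronskian is `1` if `θ' = A⁻²`. -/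
noncomputable def amplitudeFrame (A A₁ θ : ℝ → ℝ) (hA : ∀ t, A t ≠ 0) : Curve := fun t =>
  ⟨!![A₁ t * Real.sin (θ t) + Real.cos (θ t) / A t, A t * Real.sin (θ t);
      A₁ t * Real.cos (θ t) - Real.sin (θ t) / A t, A t * Real.cos (θ t)], by
    have hAt := hA t
    rw [Matrix.det_fin_two_of]
    field_simp
    linear_combination Real.sin_sq_add_cos_sq (θ t)⟩

lemma isSmooth_amplitudeFrame {A A₁ θ : ℝ → ℝ} (hA : ∀ t, A t ≠ 0) (hAs : ContDiff ℝ ∞ A)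
    (hA₁s : ContDiff ℝ ∞ A₁) (hθs : ContDiff ℝ ∞ θ) : IsSmooth (amplitudeFrame A A₁ θ hA) := by
  intro i j
  fin_cases i <;> fin_cases j
  exacts [(hA₁s.mul hθs.sin).add (hθs.cos.div hAs hA), hAs.mul hθs.sin,
    (hA₁s.mul hθs.cos).sub (hθs.sin.div hAs hA), hAs.mul hθs.cos]

lemma isHillFrame_amplitudeFrame {A A₁ θ κ : ℝ → ℝ} (hA : ∀ t, A t ≠ 0)
    (hdA : ∀ t, HasDerivAt A (A₁ t) t) (hdA₁ : ∀ t, HasDerivAt A₁ (κ t * A t + 1 / A t ^ 3) t)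
    (hdθ : ∀ t, HasDerivAt θ (1 / A t ^ 2) t) :
    IsHillFrame (amplitudeFrame A A₁ θ hA) κ fun _ => 1 := by
  intro t
  have hAt := hA t
  have hsin := (hdθ t).sin
  have hcos := (hdθ t).cos
  rw [hasDerivAt_iff_entries, mul_hillMatrix]
  intro i j
  fin_cases i <;> fin_cases j <;>
    simp only [amplitudeFrame, Fin.zero_eta, Fin.mk_one, Matrix.of_apply, Matrix.cons_val',
      Matrix.cons_val_zero, Matrix.cons_val_one, Matrix.cons_val_fin_one]
  · exact (((hdA₁ t).mul hsin).add (hcos.div (hdA t) hAt)).congr_deriv (by field_simp; ring)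
  · exact ((hdA t).mul hsin).congr_deriv (by field_simp)
  · exact (((hdA₁ t).mul hcos).sub (hsin.div (hdA t) hAt)).congr_deriv (by field_simp; ring)
  · exact ((hdA t).mul hcos).congr_deriv (by field_simp; ring)

lemma periodic_amplitudeFrame {A A₁ θ : ℝ → ℝ} {T : ℝ} {a : ℤ} (hA : ∀ t, A t ≠ 0)
    (hAp : Function.Periodic A T) (hA₁p : Function.Periodic A₁ T)
    (hθp : ∀ t, θ (t + T) = θ t + a * (2 * Real.pi)) :
    Function.Periodic (amplitudeFrame A A₁ θ hA) T := fun t => Subtype.ext <| by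
  simp only [amplitudeFrame, hAp t, hA₁p t, hθp, Real.cos_add_int_mul_two_pi,
    Real.sin_add_int_mul_two_pi]

variable {d t : ℝ} {y y₁ : ℝ → ℝ}

lemma hasDerivAt_sqrt_div (hd : 0 < d) (hpos : ∀ t, 0 < y t) (hy : HasDerivAt y (y₁ t) t) :
    HasDerivAt (fun s => √(y s / d)) (y₁ t / (2 * d * √(y t / d))) t := by
  have hA : √(y t / d) ≠ 0 := (Real.sqrt_pos.2 (div_pos (hpos t) hd)).ne'
  exact ((hy.div_const d).sqrt (div_pos (hpos t) hd).ne').congr_deriv (by field_simp)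

/-- The square root of a conserved quadratic form in two solutions of Hill's equation solves the
Ermakov equation `A'' = κ A + A⁻³`. -/
lemma hasDerivAt_deriv_sqrt_div {κ y₂ : ℝ} (hd : 0 < d) (hpos : ∀ t, 0 < y t)
    (hy : HasDerivAt y (y₁ t) t) (hy₁ : HasDerivAt y₁ y₂ t)
    (hdet : κ * y t ^ 2 + y₁ t ^ 2 / 4 - y t * y₂ / 2 = -d ^ 2) :
    HasDerivAt (fun s => y₁ s / (2 * d * √(y s / d))) (κ * √(y t / d) + 1 / √(y t / d) ^ 3) t := by
  have hA : √(y t / d) ≠ 0 := (Real.sqrt_pos.2 (div_pos (hpos t) hd)).ne'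
  have hsq : y t = d * √(y t / d) ^ 2 := by
    rw [Real.sq_sqrt (div_pos (hpos t) hd).le, mul_div_cancel₀ _ hd.ne']
  refine (hy₁.div ((hasDerivAt_sqrt_div hd hpos hy).const_mul (2 * d))
    (mul_ne_zero (by positivity) hA)).congr_deriv ?_
  rw [hsq] at hdet
  generalize √(y t / d) = A at hA hdet ⊢
  have hd' := hd.ne'
  field_simp
  linear_combination (-4) * hdet

end AmplitudeFrames

section Phase

lemma contDiff_of_autonomous {g φ : ℝ → ℝ} (hg : ContDiff ℝ ∞ g)
    (hφ : ∀ t, HasDerivAt φ (g (φ t)) t) : ContDiff ℝ ∞ φ := by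
  rw [contDiff_infty]
  intro n
  induction n with
  | zero => exact contDiff_zero.2 (continuous_iff_continuousAt.2 fun t => (hφ t).continuousAt)
  | succ n ih =>
    have hderiv : deriv φ = g ∘ φ := funext fun t => (hφ t).deriv
    push_cast
    rw [contDiff_succ_iff_deriv, hderiv]
    exact ⟨fun t => (hφ t).differentiableAt, fun h => absurd h (by simp),
      (hg.of_le (by exact_mod_cast le_top)).comp ih⟩

/-- A global solution of `φ' = g φ` running through the whole line, which advances by `P`, a
period of `g`, in time `T`. -/
structure IsPhase (g : ℝ → ℝ) (P T : ℝ) (φ : ℝ → ℝ) : Prop where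
  pos : 0 < T
  smooth : ContDiff ℝ ∞ φ
  hasDerivAt : ∀ t, HasDerivAt φ (g (φ t)) t
  add_time : ∀ t, φ (t + T) = φ t + P
  surjective : Function.Surjective φ

/-- The phase is the inverse of the travel time `x ↦ ∫₀ˣ du / g u`. -/
lemma exists_isPhase {g : ℝ → ℝ} {P : ℝ} (hP : 0 < P) (hg : ContDiff ℝ ∞ g) (hpos : ∀ u, 0 < g u)
    (hper : Function.Periodic g P) : ∃ T φ, IsPhase g P T φ := by
  let h : ℝ → ℝ := fun u => (g u)⁻¹
  let τ : ℝ → ℝ := fun x => ∫ u in (0 : ℝ)..x, h u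
  have hc : Continuous h := hg.continuous.inv₀ fun u => (hpos u).ne'
  have hpos' : ∀ u, 0 < h u := fun u => inv_pos.2 (hpos u)
  have hper' : Function.Periodic h P := fun u => congrArg Inv.inv (hper u)
  have hInt : ∀ a b, IntervalIntegrable h MeasureTheory.volume a b := hc.intervalIntegrable
  have hτ : ∀ x, HasDerivAt τ (h x) x := fun x =>
    (hc.integral_hasStrictDerivAt 0 x).hasDerivAt
  have hmono : StrictMono τ := strictMono_of_hasDerivAt_pos hτ hpos'
  have hsurj : Function.Surjective τ :=
    (continuous_iff_continuousAt.2 fun x => (hτ x).continuousAt).surjective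
      (hper'.tendsto_atTop_intervalIntegral_of_pos' (hInt _ _) hpos' hP)
      (hper'.tendsto_atBot_intervalIntegral_of_pos' (hInt _ _) hpos' hP)
  let e := hmono.orderIsoOfSurjective τ hsurj
  have he : ∀ t, τ (e.symm t) = t := e.apply_symm_apply
  have hd : ∀ t, HasDerivAt e.symm (g (e.symm t)) t := fun t =>
    (HasDerivAt.of_local_left_inverse e.symm.continuous.continuousAt (hτ (e.symm t))
      (hpos' _).ne' (Filter.Eventually.of_forall he)).congr_deriv (inv_inv _)
  refine ⟨τ P, e.symm, intervalIntegral.intervalIntegral_pos_of_pos (hInt _ _) hpos' hP,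
    contDiff_of_autonomous hg hd, hd, fun t => hmono.injective ?_, e.symm.surjective⟩
  calc τ (e.symm (t + τ P)) = τ (e.symm t) + τ P := by rw [he, he]
    _ = τ (e.symm t + P) := by
      simpa only [zero_add] using (hper'.intervalIntegral_add_eq_add 0 (e.symm t) hInt).symm

lemma apply_add_nat_mul {f : ℝ → ℝ} {T c : ℝ} (hf : ∀ t, f (t + T) = f t + c) (n : ℕ) (t : ℝ) :
    f (t + n * T) = f t + n * c := by
  induction n with
  | zero => simp
  | succ n ih =>
    push_cast
    rw [show t + (n + 1) * T = t + n * T + T by ring, hf, ih]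
    ring

namespace IsPhase

variable {g q φ : ℝ → ℝ} {P T : ℝ}

lemma hasDerivAt_integral (h : IsPhase g P T φ) (hq : Continuous q) (t : ℝ) :
    HasDerivAt (fun s => ∫ u in (0 : ℝ)..φ s, q u) (q (φ t) * g (φ t)) t :=
  (hq.integral_hasStrictDerivAt 0 (φ t)).hasDerivAt.comp t (h.hasDerivAt t)

lemma contDiff_integral (h : IsPhase g P T φ) (hq : ContDiff ℝ ∞ q) :
    ContDiff ℝ ∞ fun s => ∫ u in (0 : ℝ)..φ s, q u := by
  have hd : ∀ x, HasDerivAt (fun x => ∫ u in (0 : ℝ)..x, q u) (q x) x := fun x =>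
    (hq.continuous.integral_hasStrictDerivAt 0 x).hasDerivAt
  have hs : ContDiff ℝ ∞ fun x => ∫ u in (0 : ℝ)..x, q u := by
    rw [contDiff_infty_iff_deriv, funext fun x => (hd x).deriv]
    exact ⟨fun x => (hd x).differentiableAt, hq⟩
  exact hs.comp h.smooth

lemma periodic_comp {α : Type*} {f : ℝ → α} (h : IsPhase g P T φ) (hf : Function.Periodic f P)
    (n : ℕ) : Function.Periodic (fun t => f (φ t)) (n * T) := fun t => by
  simpa only [apply_add_nat_mul h.add_time] using hf.nat_mul n (φ t)

lemma integral_add_time (h : IsPhase g P T φ) (hq : Continuous q) (hper : Function.Periodic q P)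
    (t : ℝ) :
    ∫ u in (0 : ℝ)..φ (t + T), q u = (∫ u in (0 : ℝ)..φ t, q u) + ∫ u in (0 : ℝ)..P, q u := by
  rw [h.add_time]
  simpa only [zero_add] using hper.intervalIntegral_add_eq_add 0 (φ t) hq.intervalIntegrable

end IsPhase

end Phase

section OscillatingCurvature

/-- The curvature at phase `u` of an extremal whose curvature oscillates in `[c - δ, c + δ]`. -/
noncomputable def curvature (c δ u : ℝ) : ℝ := c - δ * Real.cos u

/-- The speed of the phase of the curvature `c - δ cos φ`, as given by the energy integral
`k'² = 2 (k - c - δ) (k - c + δ) (k - m + 2 c)` of the Euler-Lagrange equation. -/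
noncomputable def phaseSpeed (m c δ u : ℝ) : ℝ := √(2 * (m - 3 * c + δ * Real.cos u))

/-- The derivative of the curvature with respect to the natural parameter, at phase `u`. -/
noncomputable def curvatureDeriv (m c δ u : ℝ) : ℝ := δ * Real.sin u * phaseSpeed m c δ u

/-- The second derivative of the curvature with respect to the natural parameter, at phase `u`. -/
noncomputable def curvatureDeriv₂ (m c δ u : ℝ) : ℝ :=
  3 * curvature c δ u ^ 2 - 2 * m * curvature c δ u + (2 * c * (m - 2 * c) + c ^ 2 - δ ^ 2)

variable {m c δ p T : ℝ} {φ : ℝ → ℝ}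

lemma neg_abs_le_mul_cos (δ u : ℝ) : -|δ| ≤ δ * Real.cos u := by
  refine neg_le_of_abs_le ?_
  rw [abs_mul]
  exact mul_le_of_le_one_right (abs_nonneg δ) (Real.abs_cos_le_one u)

lemma phaseSpeed_radicand_pos (hδ : |δ| < m - 3 * c) (u : ℝ) :
    0 < 2 * (m - 3 * c + δ * Real.cos u) := by
  linarith [neg_abs_le_mul_cos δ u]

lemma phaseSpeed_pos (hδ : |δ| < m - 3 * c) (u : ℝ) : 0 < phaseSpeed m c δ u :=
  Real.sqrt_pos.2 (phaseSpeed_radicand_pos hδ u)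

lemma phaseSpeed_sq (hδ : |δ| < m - 3 * c) (u : ℝ) :
    phaseSpeed m c δ u ^ 2 = 2 * (m - 3 * c + δ * Real.cos u) :=
  Real.sq_sqrt (phaseSpeed_radicand_pos hδ u).le

lemma periodic_phaseSpeed (m c δ : ℝ) : Function.Periodic (phaseSpeed m c δ) (2 * Real.pi) :=
  fun u => by simp only [phaseSpeed, Real.cos_add_two_pi]

lemma contDiff_phaseSpeed (hδ : |δ| < m - 3 * c) : ContDiff ℝ ∞ (phaseSpeed m c δ) :=
  (contDiff_const.mul (contDiff_const.add (contDiff_const.mul Real.contDiff_cos))).sqrt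
    fun u => (phaseSpeed_radicand_pos hδ u).ne'

lemma hasDerivAt_phaseSpeed (hδ : |δ| < m - 3 * c) (u : ℝ) :
    HasDerivAt (phaseSpeed m c δ) (-(δ * Real.sin u) / phaseSpeed m c δ u) u := by
  refine (((((Real.hasDerivAt_cos u).const_mul δ).const_add (m - 3 * c)).const_mul 2).sqrt
    (phaseSpeed_radicand_pos hδ u).ne').congr_deriv ?_
  rw [← phaseSpeed]
  have hne := (phaseSpeed_pos hδ u).ne'
  field_simp

lemma contDiff_curvature (c δ : ℝ) : ContDiff ℝ ∞ (curvature c δ) :=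
  contDiff_const.sub (contDiff_const.mul Real.contDiff_cos)

lemma contDiff_curvatureDeriv (hδ : |δ| < m - 3 * c) : ContDiff ℝ ∞ (curvatureDeriv m c δ) :=
  (contDiff_const.mul Real.contDiff_sin).mul (contDiff_phaseSpeed hδ)

lemma contDiff_curvatureDeriv₂ (m c δ : ℝ) : ContDiff ℝ ∞ (curvatureDeriv₂ m c δ) := by
  have hk := contDiff_curvature c δ
  unfold curvatureDeriv₂
  fun_prop

lemma range_curvature (hδ : 0 < δ) : Set.range (curvature c δ) = Set.Icc (c - δ) (c + δ) := by
  calc Set.range (curvature c δ) = (fun x => c - δ * x) '' Set.range Real.cos :=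
        Set.range_comp (fun x => c - δ * x) Real.cos
    _ = (fun y => c - y) '' ((fun x => δ * x) '' Set.Icc (-1) 1) := by
        rw [Real.range_cos, Set.image_image]
    _ = Set.Icc (c - δ) (c + δ) := by
        rw [Set.image_mul_left_Icc' hδ, Set.image_const_sub_Icc]
        congr 1 <;> ring

namespace IsPhase

lemma hasDerivAt_curvature (hφ : IsPhase (phaseSpeed m c δ) (2 * Real.pi) T φ) (t : ℝ) :
    HasDerivAt (fun s => curvature c δ (φ s)) (curvatureDeriv m c δ (φ t)) t :=
  (((hφ.hasDerivAt t).cos.const_mul δ).const_sub c).congr_deriv (by rw [curvatureDeriv]; ring)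

lemma hasDerivAt_curvatureDeriv (hδ : |δ| < m - 3 * c)
    (hφ : IsPhase (phaseSpeed m c δ) (2 * Real.pi) T φ) (t : ℝ) :
    HasDerivAt (fun s => curvatureDeriv m c δ (φ s)) (curvatureDeriv₂ m c δ (φ t)) t := by
  refine (((hφ.hasDerivAt t).sin.const_mul δ).mul
    ((hasDerivAt_phaseSpeed hδ (φ t)).comp t (hφ.hasDerivAt t))).congr_deriv ?_
  rw [Function.comp_apply, div_mul_cancel₀ _ (phaseSpeed_pos hδ (φ t)).ne', curvatureDeriv₂,
    curvature]
  linear_combination δ * Real.cos (φ t) * phaseSpeed_sq hδ (φ t) - δ ^ 2 * Real.sin_sq (φ t)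

lemma hasDerivAt_curvatureDeriv₂ (hφ : IsPhase (phaseSpeed m c δ) (2 * Real.pi) T φ) (t : ℝ) :
    HasDerivAt (fun s => curvatureDeriv₂ m c δ (φ s))
      (6 * curvature c δ (φ t) * curvatureDeriv m c δ (φ t) -
        2 * m * curvatureDeriv m c δ (φ t)) t := by
  have hk := hφ.hasDerivAt_curvature t
  exact (((hk.pow 2).const_mul 3).sub (hk.const_mul (2 * m))).add_const _ |>.congr_deriv
    (by push_cast; ring)

end IsPhase

end OscillatingCurvature

section OscillatingFrames

variable {m c δ p T : ℝ} {φ : ℝ → ℝ}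

/-- The square root of the determinant of the momentum `extremalMomentum` with `p = m + 2 σ`, which
is half the value at `p` of the cubic `(p - c - δ) (p - c + δ) (m - 2 c - p)`. -/
noncomputable def momentumNorm (m c δ p : ℝ) : ℝ :=
  √(((p - c) ^ 2 - δ ^ 2) * (m - 2 * c - p) / 2)

/-- The derivative of the angle of a frame with momentum parameter `p` with respect to the phase
of the curvature. -/
noncomputable def angleSpeed (m c δ p u : ℝ) : ℝ :=
  momentumNorm m c δ p / ((p - curvature c δ u) * phaseSpeed m c δ u)

/-- The angle by which a frame with momentum parameter `p` turns in one period of the curvature. -/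
noncomputable def rotation (m c δ p : ℝ) : ℝ := ∫ u in (0 : ℝ)..2 * Real.pi, angleSpeed m c δ p u

lemma sub_curvature_pos (h₁ : |δ| < p - c) (u : ℝ) : 0 < p - curvature c δ u := by
  rw [curvature]
  linarith [neg_abs_le_mul_cos δ u]

lemma momentumNorm_radicand_pos (h₁ : |δ| < p - c) (h₂ : p < m - 2 * c) :
    0 < ((p - c) ^ 2 - δ ^ 2) * (m - 2 * c - p) / 2 := by
  have hsq : δ ^ 2 < (p - c) ^ 2 := sq_lt_sq' (neg_lt_of_abs_lt h₁) (lt_of_abs_lt h₁)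
  exact div_pos (mul_pos (by linarith) (by linarith)) two_pos

lemma momentumNorm_pos (h₁ : |δ| < p - c) (h₂ : p < m - 2 * c) : 0 < momentumNorm m c δ p :=
  Real.sqrt_pos.2 (momentumNorm_radicand_pos h₁ h₂)

lemma momentumNorm_sq (h₁ : |δ| < p - c) (h₂ : p < m - 2 * c) :
    momentumNorm m c δ p ^ 2 = ((p - c) ^ 2 - δ ^ 2) * (m - 2 * c - p) / 2 :=
  Real.sq_sqrt (momentumNorm_radicand_pos h₁ h₂).le

lemma periodic_angleSpeed (m c δ p : ℝ) :
    Function.Periodic (angleSpeed m c δ p) (2 * Real.pi) := fun u => by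
  simp only [angleSpeed, curvature, Real.cos_add_two_pi, periodic_phaseSpeed m c δ u]

lemma contDiff_angleSpeed (h₁ : |δ| < p - c) (h₂ : p < m - 2 * c) :
    ContDiff ℝ ∞ (angleSpeed m c δ p) :=
  contDiff_const.div ((contDiff_const.sub (contDiff_curvature c δ)).mul
    (contDiff_phaseSpeed (by linarith)))
    fun u => (mul_pos (sub_curvature_pos h₁ u) (phaseSpeed_pos (by linarith) u)).ne'

lemma angleSpeed_mul_phaseSpeed (hδ : |δ| < m - 3 * c) (p u : ℝ) :
    angleSpeed m c δ p u * phaseSpeed m c δ u =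
      momentumNorm m c δ p / (p - curvature c δ u) := by
  rw [angleSpeed, ← div_div, div_mul_cancel₀ _ (phaseSpeed_pos hδ u).ne']

/-- Conservation of the determinant of `extremalMomentum`, written out for `p = m + 2 σ`. -/
lemma curvature_first_integral (h₁ : |δ| < p - c) (h₂ : p < m - 2 * c) (u : ℝ) :
    (curvature c δ u + (p - m) / 2) * (p - curvature c δ u) ^ 2 +
        (-curvatureDeriv m c δ u) ^ 2 / 4 -
        (p - curvature c δ u) * -curvatureDeriv₂ m c δ u / 2 = -momentumNorm m c δ p ^ 2 := by
  rw [momentumNorm_sq h₁ h₂, curvatureDeriv, neg_sq, mul_pow, mul_pow, phaseSpeed_sq (by linarith),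
    Real.sin_sq, curvatureDeriv₂, curvature]
  ring

/-- The two frames of an extremal are obtained from `p = m + 2` and `p = m - 2`. -/
lemma IsPhase.exists_hillFrame (h₁ : |δ| < p - c) (h₂ : p < m - 2 * c)
    (hφ : IsPhase (phaseSpeed m c δ) (2 * Real.pi) T φ) :
    ∃ Γ : Curve, IsSmooth Γ ∧
      IsHillFrame Γ (fun t => curvature c δ (φ t) + (p - m) / 2) (fun _ => 1) ∧
      ∀ (n : ℕ) (a : ℤ), n * rotation m c δ p = a * (2 * Real.pi) →
        Function.Periodic Γ (n * T) := by
  have hδ : |δ| < m - 3 * c := by linarith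
  have hd := momentumNorm_pos h₁ h₂
  set d := momentumNorm m c δ p
  have hy : ∀ t, 0 < p - curvature c δ (φ t) := fun t => sub_curvature_pos h₁ (φ t)
  have hA : ∀ t, √((p - curvature c δ (φ t)) / d) ≠ 0 := fun t =>
    (Real.sqrt_pos.2 (div_pos (hy t) hd)).ne'
  have hdy : ∀ t, HasDerivAt (fun s => p - curvature c δ (φ s)) (-curvatureDeriv m c δ (φ t)) t :=
    fun t => (hφ.hasDerivAt_curvature t).const_sub p
  have hdA : ∀ t, HasDerivAt (fun s => √((p - curvature c δ (φ s)) / d))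
      (-curvatureDeriv m c δ (φ t) / (2 * d * √((p - curvature c δ (φ t)) / d))) t := fun t =>
    hasDerivAt_sqrt_div (y := fun t => p - curvature c δ (φ t))
      (y₁ := fun t => -curvatureDeriv m c δ (φ t)) hd hy (hdy t)
  have hdA₁ := fun t => hasDerivAt_deriv_sqrt_div (y := fun t => p - curvature c δ (φ t)) hd hy
    (hdy t) (hφ.hasDerivAt_curvatureDeriv hδ t).neg (curvature_first_integral h₁ h₂ (φ t))
  have hdθ : ∀ t, HasDerivAt (fun s => ∫ u in (0 : ℝ)..φ s, angleSpeed m c δ p u)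
      (1 / √((p - curvature c δ (φ t)) / d) ^ 2) t := fun t =>
    (hφ.hasDerivAt_integral (contDiff_angleSpeed h₁ h₂).continuous t).congr_deriv (by
      rw [angleSpeed_mul_phaseSpeed hδ, Real.sq_sqrt (div_pos (hy t) hd).le, one_div_div])
  have hAs : ContDiff ℝ ∞ fun t => √((p - curvature c δ (φ t)) / d) :=
    ((contDiff_const.sub ((contDiff_curvature c δ).comp hφ.smooth)).div_const d).sqrt
      fun t => (div_pos (hy t) hd).ne'
  refine ⟨amplitudeFrame _ _ _ hA, isSmooth_amplitudeFrame hA hAs ?_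
    (hφ.contDiff_integral (contDiff_angleSpeed h₁ h₂)),
    isHillFrame_amplitudeFrame hA hdA hdA₁ hdθ, fun n a hna =>
    periodic_amplitudeFrame (a := a) hA ?_ ?_ fun t => ?_⟩
  · exact ((contDiff_curvatureDeriv hδ).comp hφ.smooth).neg.div (contDiff_const.mul hAs)
      fun t => mul_ne_zero (by positivity) (hA t)
  · exact hφ.periodic_comp (f := fun u => √((p - curvature c δ u) / d))
      (fun u => by simp only [curvature, Real.cos_add_two_pi]) n
  · exact hφ.periodic_comp
      (f := fun u => -curvatureDeriv m c δ u / (2 * d * √((p - curvature c δ u) / d)))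
      (fun u => by simp only [curvature, curvatureDeriv, Real.cos_add_two_pi, Real.sin_add_two_pi,
        periodic_phaseSpeed m c δ u]) n
  · rw [← hna]
    exact apply_add_nat_mul (f := fun t => ∫ u in (0 : ℝ)..φ t, angleSpeed m c δ p u)
      (hφ.integral_add_time (contDiff_angleSpeed h₁ h₂).continuous
        (periodic_angleSpeed m c δ p)) n t

end OscillatingFrames

section Trajectories

/-- `γ` is a spinor curve in the natural parameter whose curvature takes the values `S`. -/
def HasCurvatureRange (γ : Curve) (S : Set ℝ) : Prop :=
  ∃ (Γp Γm : Curve) (k : ℝ → ℝ), IsSpinorFrame γ Γp Γm k (fun _ => 1) ∧ Set.range k = S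

lemma IsSmooth.translate {Γ : Curve} (h : IsSmooth Γ) (A : SL(2, ℝ)) (c : ℝ) :
    IsSmooth fun s => A * Γ (s + c) :=
  IsSmooth.mul (fun _ _ => contDiff_const) fun i j =>
    (h i j).comp (contDiff_id.add contDiff_const)

lemma IsHillFrame.translate {Γ : Curve} {κ w : ℝ → ℝ} (h : IsHillFrame Γ κ w) (A : SL(2, ℝ))
    (c : ℝ) :
    IsHillFrame (fun s => A * Γ (s + c)) (fun s => κ (s + c)) (fun s => w (s + c)) := fun t => by
  simp only [Matrix.SpecialLinearGroup.coe_mul]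
  exact (((h (t + c)).comp_add_const t c).const_mul (A : Mat)).congr_deriv
    (Matrix.mul_assoc _ _ _).symm

lemma IsSpinorFrame.translate {γ Γp Γm : Curve} {k w : ℝ → ℝ} (h : IsSpinorFrame γ Γp Γm k w)
    (A B : SL(2, ℝ)) (c : ℝ) :
    IsSpinorFrame (fun s => A * γ (s + c) * B⁻¹) (fun s => A * Γp (s + c))
      (fun s => B * Γm (s + c)) (fun s => k (s + c)) (fun s => w (s + c)) where
  smooth_plus := h.smooth_plus.translate A c
  smooth_minus := h.smooth_minus.translate B c
  smooth_curvature := h.smooth_curvature.comp (contDiff_id.add contDiff_const)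
  smooth_arc := h.smooth_arc.comp (contDiff_id.add contDiff_const)
  arc_ne_zero t := h.arc_ne_zero (t + c)
  lift t := by rw [h.lift, mul_inv_rev]; simp only [mul_assoc]
  plus := (h.isHillFrame_plus.translate A c).leftVelocity_eq
  minus := (h.isHillFrame_minus.translate B c).leftVelocity_eq

lemma HasCurvatureRange.eq_of_equivalent {γ γ' : Curve} {S S' : Set ℝ}
    (h : HasCurvatureRange γ S) (h' : HasCurvatureRange γ' S') (he : Equivalent γ γ') :
    S = S' := by
  obtain ⟨Γp, Γm, k, hf, rfl⟩ := h
  obtain ⟨Γp', Γm', k', hf', rfl⟩ := h'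
  obtain ⟨c, A, B, hAB⟩ := he
  have hk : (fun t => k (t + c)) = k' := funext fun t =>
    (hf.translate A B c).curvature_eq hf' isOpen_univ (fun s _ => (hAB s).symm) (Set.mem_univ t)
  rw [← hk]
  exact ((Equiv.addRight c).surjective.range_comp k).symm

variable {m c δ : ℝ}

lemma IsPhase.isTrajectory {T : ℝ} {φ : ℝ → ℝ} {γ Γp Γm : Curve} (hδ : 0 < δ)
    (h : δ < m - 3 * c) (hφ : IsPhase (phaseSpeed m c δ) (2 * Real.pi) T φ)
    (hf : IsSpinorFrame γ Γp Γm (fun t => curvature c δ (φ t)) fun _ => 1) :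
    IsTrajectory m γ ∧ HasCurvatureRange γ (Set.Icc (c - δ) (c + δ)) := by
  have hδ' : |δ| < m - 3 * c := by rwa [abs_of_pos hδ]
  have hrange : Set.range (fun t => curvature c δ (φ t)) = Set.Icc (c - δ) (c + δ) :=
    (hφ.surjective.range_comp (curvature c δ)).trans (range_curvature hδ)
  have hnonconst : ¬ ∃ r, ∀ t, curvature c δ (φ t) = r := by
    rintro ⟨r, hr⟩
    obtain ⟨s, hs⟩ := hrange.symm.subset (Set.left_mem_Icc.2 (by linarith))
    obtain ⟨t, ht⟩ := hrange.symm.subset (Set.right_mem_Icc.2 (by linarith))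
    simp only [hr] at hs ht
    linarith
  exact ⟨⟨hf.isNullCurve, hf.noFlex, ⟨Γp, Γm, _, hf, hnonconst⟩,
    hf.isCritical ((contDiff_curvatureDeriv hδ').comp hφ.smooth)
      ((contDiff_curvatureDeriv₂ m c δ).comp hφ.smooth) hφ.hasDerivAt_curvature
      (hφ.hasDerivAt_curvatureDeriv hδ') hφ.hasDerivAt_curvatureDeriv₂⟩, Γp, Γm, _, hf, hrange⟩

lemma exists_isTrajectory_isPeriodic {q r : ℚ} (hδ : 0 < δ) (h₁ : c + δ < m - 2) (h₂ : c < -1)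
    (hq : rotation m c δ (m + 2) = Real.pi * q) (hr : rotation m c δ (m - 2) = Real.pi * r) :
    ∃ γ, IsTrajectory m γ ∧ IsPeriodic γ ∧ HasCurvatureRange γ (Set.Icc (c - δ) (c + δ)) := by
  have habs := abs_of_pos hδ
  obtain ⟨T, φ, hφ⟩ := exists_isPhase Real.two_pi_pos
    (contDiff_phaseSpeed (m := m) (c := c) (by linarith))
    (phaseSpeed_pos (by linarith)) (periodic_phaseSpeed m c δ)
  obtain ⟨Γp, hsp, hHp, hperp⟩ := hφ.exists_hillFrame (p := m + 2) (by linarith) (by linarith)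
  obtain ⟨Γm, hsm, hHm, hperm⟩ := hφ.exists_hillFrame (p := m - 2) (by linarith) (by linarith)
  have hf : IsSpinorFrame (fun t => Γp t * (Γm t)⁻¹) Γp Γm (fun t => curvature c δ (φ t))
      fun _ => 1 :=
    { smooth_plus := hsp
      smooth_minus := hsm
      smooth_curvature := (contDiff_curvature c δ).comp hφ.smooth
      smooth_arc := contDiff_const
      arc_ne_zero := fun _ => one_ne_zero
      lift := fun _ => rfl
      plus := fun t => by rw [hHp.leftVelocity_eq, hillMatrix]; congr 5; ring
      minus := fun t => by rw [hHm.leftVelocity_eq, hillMatrix]; congr 5; ring }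
  obtain ⟨htraj, hrange⟩ := hφ.isTrajectory hδ (by linarith) hf
  have hqd : (q : ℝ) * q.den = q.num := by exact_mod_cast Rat.mul_den_eq_num q
  have hrd : (r : ℝ) * r.den = r.num := by exact_mod_cast Rat.mul_den_eq_num r
  have hp := hperp (2 * q.den * r.den) (q.num * r.den) (by
    rw [hq]; push_cast; linear_combination 2 * r.den * Real.pi * hqd)
  have hm := hperm (2 * q.den * r.den) (r.num * q.den) (by
    rw [hr]; push_cast; linear_combination 2 * q.den * Real.pi * hrd)
  have hden : 0 < 2 * q.den * r.den := by have := q.den_pos; have := r.den_pos; positivity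
  exact ⟨_, htraj, ⟨_, mul_pos (Nat.cast_pos.2 hden) hφ.pos, hp.mul (hm.comp (·⁻¹))⟩, hrange⟩

end Trajectories

section EllipticAnomaly

/-- The polar equation, in terms of the cosine `x` of the true anomaly, of the ellipse of
eccentricity `τ` and semi-major axis `1` with respect to a focus. For `τ = 1` the value is `0`,
by the convention `0 / 0 = 0` also for `x = 1`. -/
noncomputable def ellipseRadius (τ x : ℝ) : ℝ := (1 - τ ^ 2) / (1 - τ * x)

/-- The true anomaly on the ellipse of eccentricity `2 β / (1 + β ^ 2)` as a function of the
eccentric anomaly, which is measured here so that the distance from the focus is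
`1 + τ cos u`. -/
noncomputable def trueAnomaly (β u : ℝ) : ℝ :=
  u - 2 * Real.arctan (β * Real.sin u / (1 + β * Real.cos u))

variable {β τ u x : ℝ}

lemma one_add_mul_cos_pos (hτ : |τ| < 1) (u : ℝ) : 0 < 1 + τ * Real.cos u := by
  linarith [neg_abs_le_mul_cos τ u]

lemma one_sub_mul_pos (hτ : |τ| < 1) (hx : |x| ≤ 1) : 0 < 1 - τ * x := by
  have h : |τ * x| ≤ |τ| := by
    rw [abs_mul]
    exact mul_le_of_le_one_right (abs_nonneg τ) hx
  linarith [le_abs_self (τ * x)]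

lemma ellipseRadius_pos (hτ : |τ| < 1) (hx : |x| ≤ 1) : 0 < ellipseRadius τ x :=
  div_pos (sub_pos.2 ((sq_lt_one_iff_abs_lt_one τ).2 hτ)) (one_sub_mul_pos hτ hx)

lemma continuous_ellipseRadius_cos (hτ : |τ| < 1) :
    Continuous fun ψ => ellipseRadius τ (Real.cos ψ) :=
  continuous_const.div (continuous_const.sub (continuous_const.mul Real.continuous_cos))
    fun ψ => (one_sub_mul_pos hτ (Real.abs_cos_le_one ψ)).ne'

lemma one_add_mul_cos_sq_add_mul_sin_sq (β u : ℝ) :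
    (1 + β * Real.cos u) ^ 2 + (β * Real.sin u) ^ 2 = 1 + β ^ 2 + 2 * β * Real.cos u := by
  linear_combination β ^ 2 * Real.sin_sq_add_cos_sq u

lemma one_add_sq_add_mul_cos_pos (hβ : |β| < 1) (u : ℝ) :
    0 < 1 + β ^ 2 + 2 * β * Real.cos u := by
  rw [← one_add_mul_cos_sq_add_mul_sin_sq]
  have := one_add_mul_cos_pos hβ u
  positivity

lemma one_add_div_sq (hβ : |β| < 1) (u : ℝ) :
    1 + (β * Real.sin u / (1 + β * Real.cos u)) ^ 2 =
      (1 + β ^ 2 + 2 * β * Real.cos u) / (1 + β * Real.cos u) ^ 2 := by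
  have hden := (one_add_mul_cos_pos hβ u).ne'
  rw [← one_add_mul_cos_sq_add_mul_sin_sq, div_pow, add_div, div_self (pow_ne_zero 2 hden)]

lemma hasDerivAt_trueAnomaly (hβ : |β| < 1) (u : ℝ) :
    HasDerivAt (trueAnomaly β) ((1 - β ^ 2) / (1 + β ^ 2 + 2 * β * Real.cos u)) u := by
  have hden := (one_add_mul_cos_pos hβ u).ne'
  refine ((hasDerivAt_id u).sub ((((Real.hasDerivAt_sin u).const_mul β).div
    (((Real.hasDerivAt_cos u).const_mul β).const_add 1) hden).arctan.const_mul 2)).congr_deriv ?_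
  have hN := (one_add_sq_add_mul_cos_pos hβ u).ne'
  rw [Pi.div_apply, one_add_div_sq hβ]
  field_simp
  linear_combination -2 * β ^ 2 * Real.sin_sq_add_cos_sq u

lemma cos_two_mul_arctan (x : ℝ) :
    Real.cos (2 * Real.arctan x) = (1 - x ^ 2) / (1 + x ^ 2) := by
  have hx : 1 + x ^ 2 ≠ 0 := by positivity
  rw [Real.cos_two_mul, Real.cos_sq_arctan]
  field_simp
  ring

lemma sin_two_mul_arctan (x : ℝ) : Real.sin (2 * Real.arctan x) = 2 * x / (1 + x ^ 2) := by
  rw [Real.sin_two_mul, Real.sin_arctan, Real.cos_arctan, mul_assoc, div_mul_div_comm, mul_one,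
    Real.mul_self_sqrt (by positivity), mul_div_assoc]

lemma cos_trueAnomaly (hβ : |β| < 1) (u : ℝ) :
    Real.cos (trueAnomaly β u) =
      ((1 + β ^ 2) * Real.cos u + 2 * β) / (1 + β ^ 2 + 2 * β * Real.cos u) := by
  have hden := (one_add_mul_cos_pos hβ u).ne'
  have hN := (one_add_sq_add_mul_cos_pos hβ u).ne'
  have hcos : Real.cos (2 * Real.arctan (β * Real.sin u / (1 + β * Real.cos u))) =
      ((1 + β * Real.cos u) ^ 2 - (β * Real.sin u) ^ 2) / (1 + β ^ 2 + 2 * β * Real.cos u) := by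
    rw [cos_two_mul_arctan, one_add_div_sq hβ]
    field_simp
  have hsin : Real.sin (2 * Real.arctan (β * Real.sin u / (1 + β * Real.cos u))) =
      2 * (β * Real.sin u) * (1 + β * Real.cos u) / (1 + β ^ 2 + 2 * β * Real.cos u) := by
    rw [sin_two_mul_arctan, one_add_div_sq hβ]
    field_simp
  rw [trueAnomaly, Real.cos_sub, hcos, hsin, ← mul_div_assoc, ← mul_div_assoc, ← add_div]
  congr 1
  linear_combination (2 * β + β ^ 2 * Real.cos u) * Real.sin_sq_add_cos_sq u

lemma ellipseRadius_cos_trueAnomaly (hβ : |β| < 1) (u : ℝ) :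
    ellipseRadius (2 * β / (1 + β ^ 2)) (Real.cos (trueAnomaly β u)) =
      1 + 2 * β / (1 + β ^ 2) * Real.cos u := by
  have hN := (one_add_sq_add_mul_cos_pos hβ u).ne'
  have hβ' : 1 - β ^ 2 ≠ 0 := (sub_pos.2 ((sq_lt_one_iff_abs_lt_one β).2 hβ)).ne'
  have hq : 1 + β ^ 2 ≠ 0 := by positivity
  have hsub : 1 - 2 * β / (1 + β ^ 2) * Real.cos (trueAnomaly β u) =
      (1 - β ^ 2) ^ 2 / ((1 + β ^ 2) * (1 + β ^ 2 + 2 * β * Real.cos u)) := by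
    rw [cos_trueAnomaly hβ]
    field_simp
    ring
  have hsq : 1 - (2 * β / (1 + β ^ 2)) ^ 2 = (1 - β ^ 2) ^ 2 / (1 + β ^ 2) ^ 2 := by
    field_simp
    ring
  rw [ellipseRadius, hsub, hsq]
  field_simp

lemma exists_eq_two_mul_div_one_add_sq (hτ : |τ| < 1) :
    ∃ β, |β| < 1 ∧ τ = 2 * β / (1 + β ^ 2) ∧ √(1 - τ ^ 2) = (1 - β ^ 2) / (1 + β ^ 2) := by
  have hτ' : 0 < 1 - τ ^ 2 := sub_pos.2 ((sq_lt_one_iff_abs_lt_one τ).2 hτ)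
  have hs := Real.sqrt_pos.2 hτ'
  have hs2 := Real.sq_sqrt hτ'.le
  set s := √(1 - τ ^ 2)
  have hβ : (τ / (1 + s)) ^ 2 = (1 - s) / (1 + s) := by
    rw [div_pow, div_eq_div_iff (by positivity) (by positivity)]
    linear_combination (1 + s) * hs2
  have hq : 1 + (τ / (1 + s)) ^ 2 = 2 / (1 + s) := by
    rw [hβ]
    field_simp
    ring
  refine ⟨τ / (1 + s), ?_, ?_, ?_⟩
  · rw [abs_div, abs_of_pos (by positivity : 0 < 1 + s), div_lt_one (by positivity)]
    linarith
  · rw [hq]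
    field_simp
  · rw [hq, hβ]
    field_simp
    ring

lemma integral_comp_ellipseRadius {F : ℝ → ℝ} (hτ : |τ| < 1) (hF : ContinuousOn F (Set.Ioi 0)) :
    ∫ u in (0 : ℝ)..2 * Real.pi, F (1 + τ * Real.cos u) * (√(1 - τ ^ 2) / (1 + τ * Real.cos u)) =
      ∫ ψ in (0 : ℝ)..2 * Real.pi, F (ellipseRadius τ (Real.cos ψ)) := by
  obtain ⟨β, hβ, rfl, hs⟩ := exists_eq_two_mul_div_one_add_sq hτ
  have hderiv : ∀ u, HasDerivAt (trueAnomaly β)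
      (√(1 - (2 * β / (1 + β ^ 2)) ^ 2) / (1 + 2 * β / (1 + β ^ 2) * Real.cos u)) u := fun u =>
    (hasDerivAt_trueAnomaly hβ u).congr_deriv (by
      have hq : 1 + β ^ 2 ≠ 0 := by positivity
      rw [hs, div_div, mul_add, mul_one, ← mul_assoc, mul_div_cancel₀ _ hq])
  have hc : Continuous fun ψ => F (ellipseRadius (2 * β / (1 + β ^ 2)) (Real.cos ψ)) :=
    hF.comp_continuous (continuous_ellipseRadius_cos hτ) fun ψ =>
      ellipseRadius_pos hτ (Real.abs_cos_le_one ψ)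
  have hsubst := intervalIntegral.integral_comp_mul_deriv (a := 0) (b := 2 * Real.pi)
    (fun u _ => hderiv u) (Continuous.continuousOn (continuous_const.div (by fun_prop)
      fun u => (one_add_mul_cos_pos hτ u).ne')) hc
  simp only [Function.comp_apply, ellipseRadius_cos_trueAnomaly hβ] at hsubst
  simpa only [trueAnomaly, Real.sin_zero, Real.sin_two_pi, mul_zero, zero_div, Real.arctan_zero,
    sub_zero] using hsubst

end EllipticAnomaly

section RotationIntegral

/-- The integrand of `rotationIntegral` at a point of true anomaly `ψ`, as a function of
`x = cos ψ`. -/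
noncomputable def rotationKernel (ρ τ x : ℝ) : ℝ := (√(1 + ρ * ellipseRadius τ x))⁻¹

/-- Twice the rotation angle `rotation m c δ p`, in terms of the parameters
`ρ = (p - c) / (m - 2 c - p)` and `τ = δ / (p - c)`. -/
noncomputable def rotationIntegral (ρ τ : ℝ) : ℝ :=
  ∫ ψ in (0 : ℝ)..2 * Real.pi, rotationKernel ρ τ (Real.cos ψ)

variable {m c p ρ τ τ' x : ℝ}

lemma momentumNorm_eq (hp : 0 < p - c) (hτ : |τ| < 1) :
    momentumNorm m c ((p - c) * τ) p = (p - c) * √(1 - τ ^ 2) * √((m - 2 * c - p) / 2) := by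
  have hτ' : 0 ≤ 1 - τ ^ 2 := sub_nonneg.2 ((sq_le_one_iff_abs_le_one τ).2 hτ.le)
  rw [momentumNorm, ← Real.sqrt_sq hp.le, mul_assoc, ← Real.sqrt_mul hτ',
    ← Real.sqrt_mul (sq_nonneg _), Real.sqrt_sq hp.le]
  congr 1
  ring

lemma phaseSpeed_eq (h : 0 < m - 2 * c - p) (u : ℝ) :
    phaseSpeed m c ((p - c) * τ) u = 2 * √((m - 2 * c - p) / 2) *
      √(1 + (p - c) / (m - 2 * c - p) * (1 + τ * Real.cos u)) := by
  have hrad : 2 * (m - 3 * c + (p - c) * τ * Real.cos u) = 2 ^ 2 * ((m - 2 * c - p) / 2 *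
      (1 + (p - c) / (m - 2 * c - p) * (1 + τ * Real.cos u))) := by
    field_simp
    ring
  rw [phaseSpeed, hrad, Real.sqrt_mul (sq_nonneg 2), Real.sqrt_sq zero_le_two,
    Real.sqrt_mul (half_pos h).le, mul_assoc]

lemma angleSpeed_eq (hp : 0 < p - c) (h : 0 < m - 2 * c - p) (hτ : |τ| < 1) (u : ℝ) :
    angleSpeed m c ((p - c) * τ) p u =
      (√(1 + (p - c) / (m - 2 * c - p) * (1 + τ * Real.cos u)))⁻¹ *
        (√(1 - τ ^ 2) / (1 + τ * Real.cos u)) / 2 := by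
  have hpos := one_add_mul_cos_pos hτ u
  have hroot : 0 < √((m - 2 * c - p) / 2) := Real.sqrt_pos.2 (half_pos h)
  have hsub : p - curvature c ((p - c) * τ) u = (p - c) * (1 + τ * Real.cos u) := by
    rw [curvature]
    ring
  have hroot' : 0 < √(1 + (p - c) / (m - 2 * c - p) * (1 + τ * Real.cos u)) :=
    Real.sqrt_pos.2 (by positivity)
  rw [angleSpeed, momentumNorm_eq hp hτ, phaseSpeed_eq h, hsub]
  generalize √((m - 2 * c - p) / 2) = A at *
  generalize √(1 + (p - c) / (m - 2 * c - p) * (1 + τ * Real.cos u)) = B at *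
  field_simp

lemma rotation_eq (hp : 0 < p - c) (h : 0 < m - 2 * c - p) (hτ : |τ| < 1) :
    rotation m c ((p - c) * τ) p = rotationIntegral ((p - c) / (m - 2 * c - p)) τ / 2 := by
  have hF : ContinuousOn (fun r : ℝ => (√(1 + (p - c) / (m - 2 * c - p) * r))⁻¹) (Set.Ioi 0) := by
    refine ContinuousOn.inv₀ (by fun_prop) fun r hr => ?_
    have hr' : 0 < r := hr
    positivity
  simp only [rotation, angleSpeed_eq hp h hτ, intervalIntegral.integral_div]
  rw [integral_comp_ellipseRadius hτ hF]
  rfl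

lemma ellipseRadius_zero (x : ℝ) : ellipseRadius 0 x = 1 := by simp [ellipseRadius]

lemma ellipseRadius_one (x : ℝ) : ellipseRadius 1 x = 0 := by simp [ellipseRadius]

lemma ellipseRadius_nonneg (h₀ : 0 ≤ τ) (h₁ : τ ≤ 1) (hx : |x| ≤ 1) : 0 ≤ ellipseRadius τ x := by
  rcases h₁.eq_or_lt with rfl | h₁
  · exact (ellipseRadius_one x).ge
  · exact (ellipseRadius_pos (abs_lt.2 ⟨by linarith, h₁⟩) hx).le

lemma rotationKernel_one (ρ x : ℝ) : rotationKernel ρ 1 x = 1 := by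
  simp [rotationKernel, ellipseRadius_one]

lemma rotationKernel_le_one (hρ : 0 ≤ ρ) (h₀ : 0 ≤ τ) (h₁ : τ ≤ 1) (hx : |x| ≤ 1) :
    rotationKernel ρ τ x ≤ 1 := by
  have h := mul_nonneg hρ (ellipseRadius_nonneg h₀ h₁ hx)
  exact inv_le_one_of_one_le₀ (Real.one_le_sqrt.2 (by linarith))

lemma continuous_rotationKernel_cos (hρ : 0 ≤ ρ) (h₀ : 0 ≤ τ) (h₁ : τ ≤ 1) :
    Continuous fun ψ => rotationKernel ρ τ (Real.cos ψ) := by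
  rcases h₁.eq_or_lt with rfl | h₁
  · simp only [rotationKernel_one]
    exact continuous_const
  · have hr := continuous_ellipseRadius_cos (abs_lt.2 ⟨by linarith, h₁⟩)
    refine (continuous_const.add (continuous_const.mul hr)).sqrt.inv₀ fun ψ => ?_
    exact (Real.sqrt_pos.2 (add_pos_of_pos_of_nonneg one_pos
      (mul_nonneg hρ (ellipseRadius_nonneg h₀ h₁.le (Real.abs_cos_le_one ψ))))).ne'

lemma rotationIntegral_zero (ρ : ℝ) : rotationIntegral ρ 0 = 2 * Real.pi / √(1 + ρ) := by
  simp [rotationIntegral, rotationKernel, ellipseRadius_zero, div_eq_mul_inv]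

lemma rotationIntegral_one (ρ : ℝ) : rotationIntegral ρ 1 = 2 * Real.pi := by
  simp [rotationIntegral, rotationKernel_one]

lemma rotationIntegral_le (hρ : 0 ≤ ρ) (h₀ : 0 ≤ τ) (h₁ : τ < 1) :
    rotationIntegral ρ τ ≤ 2 * Real.pi / √(1 + ρ * (1 - τ)) := by
  have hpoint : ∀ ψ, rotationKernel ρ τ (Real.cos ψ) ≤ (√(1 + ρ * (1 - τ)))⁻¹ := fun ψ => by
    have hτ : 0 < 1 - τ := sub_pos.2 h₁
    have hle : 1 - τ ≤ ellipseRadius τ (Real.cos ψ) := by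
      rw [ellipseRadius, le_div_iff₀ (one_sub_mul_pos (abs_lt.2 ⟨by linarith, h₁⟩)
        (Real.abs_cos_le_one ψ))]
      have := mul_nonneg (mul_nonneg hτ.le h₀) (neg_le_iff_add_nonneg.1 (Real.neg_one_le_cos ψ))
      linarith
    rw [rotationKernel]
    gcongr
  refine (intervalIntegral.integral_mono_on Real.two_pi_pos.le
    ((continuous_rotationKernel_cos hρ h₀ h₁.le).intervalIntegrable _ _)
    (continuous_const.intervalIntegrable _ _) fun ψ _ => hpoint ψ).trans_eq ?_
  rw [intervalIntegral.integral_const, sub_zero, smul_eq_mul, div_eq_mul_inv]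

lemma continuousAt_rotationKernel (hρ : 0 ≤ ρ) (h₀ : 0 ≤ τ) (h₁ : τ ≤ 1) (hx : |x| ≤ 1)
    (hx' : x < 1) : ContinuousAt (fun z : ℝ × ℝ => rotationKernel z.1 z.2 x) (ρ, τ) := by
  have hden : 1 - τ * x ≠ 0 := by
    have := mul_nonneg h₀ (sub_nonneg.2 hx'.le)
    rcases h₁.eq_or_lt with rfl | h₁ <;> linarith
  have hpos := mul_nonneg hρ (ellipseRadius_nonneg h₀ h₁ hx)
  exact ContinuousAt.inv₀ ((continuousAt_const.add (continuousAt_fst.mul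
    (ContinuousAt.div (by fun_prop) (by fun_prop) hden))).sqrt) (Real.sqrt_pos.2 (by linarith)).ne'

lemma continuousOn_rotationIntegral :
    ContinuousOn (fun z : ℝ × ℝ => rotationIntegral z.1 z.2) (Set.Ici 0 ×ˢ Set.Icc 0 1) := by
  rintro ⟨ρ₀, τ₀⟩ ⟨hρ₀, h₀, h₁⟩
  refine intervalIntegral.continuousWithinAt_of_dominated_interval (bound := fun _ => 1) ?_ ?_
    (continuous_const.intervalIntegrable _ _) ?_
  · filter_upwards [self_mem_nhdsWithin] with z hz
    exact (continuous_rotationKernel_cos hz.1 hz.2.1 hz.2.2).aestronglyMeasurable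
  · filter_upwards [self_mem_nhdsWithin] with z hz
    refine Filter.Eventually.of_forall fun ψ _ => ?_
    rw [rotationKernel, Real.norm_of_nonneg (inv_nonneg.2 (Real.sqrt_nonneg _)), ← rotationKernel]
    exact rotationKernel_le_one hz.1 hz.2.1 hz.2.2 (Real.abs_cos_le_one ψ)
  -- The kernel is discontinuous at `τ = 1` where `cos ψ = 1`, that is, at the endpoints.
  · filter_upwards [MeasureTheory.Measure.ae_ne MeasureTheory.volume (2 * Real.pi)] with ψ hψ hmem
    rw [Set.uIoc_of_le Real.two_pi_pos.le] at hmem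
    have hcos : Real.cos ψ < 1 := (Real.cos_le_one ψ).lt_of_ne fun h =>
      hmem.1.ne' ((Real.cos_eq_one_iff_of_lt_of_lt (by linarith [hmem.1, Real.pi_pos])
        (hmem.2.lt_of_ne hψ)).1 h)
    exact (continuousAt_rotationKernel hρ₀ h₀ h₁ (Real.abs_cos_le_one ψ) hcos).continuousWithinAt

lemma inv_sqrt_sub_mul_le_inv_sqrt {a x : ℝ} (ha : 0 < a) (hx : 0 < x) :
    (√a)⁻¹ - (x - a) * (2 * a * √a)⁻¹ ≤ (√x)⁻¹ := by
  have hs := Real.sqrt_pos.2 ha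
  have hr := Real.sqrt_pos.2 hx
  nth_rewrite 2 [← Real.sq_sqrt ha.le]
  nth_rewrite 3 [← Real.sq_sqrt ha.le]
  nth_rewrite 1 [← Real.sq_sqrt hx.le]
  generalize √a = s at *
  generalize √x = r at *
  have hdiff : r⁻¹ - (s⁻¹ - (r ^ 2 - s ^ 2) * (2 * s ^ 2 * s)⁻¹) =
      (r - s) ^ 2 * (r + 2 * s) / (2 * s ^ 3 * r) := by
    field_simp
    ring
  have hnonneg : 0 ≤ (r - s) ^ 2 * (r + 2 * s) / (2 * s ^ 3 * r) := by positivity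
  linarith

lemma inv_sqrt_add_inv_sqrt_le {a b a' b' : ℝ} (hb : 0 < b) (hba : b ≤ a) (ha' : 0 < a')
    (hb' : 0 < b') (hle : b' ≤ b) (hsum : a' + b' ≤ a + b) :
    (√a)⁻¹ + (√b)⁻¹ ≤ (√a')⁻¹ + (√b')⁻¹ := by
  have ha := hb.trans_le hba
  have hta := inv_sqrt_sub_mul_le_inv_sqrt ha ha'
  have htb := inv_sqrt_sub_mul_le_inv_sqrt hb hb'
  have hslope : (2 * a * √a)⁻¹ ≤ (2 * b * √b)⁻¹ := by gcongr
  have hslope₀ : 0 ≤ (2 * a * √a)⁻¹ := by positivity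
  linarith [mul_nonneg (sub_nonneg.2 hle) (sub_nonneg.2 hslope),
    mul_nonneg (sub_nonneg.2 hsum) hslope₀]

lemma ellipseRadius_add_ellipseRadius_neg (hτ : |τ| < 1) (hx : |x| ≤ 1) :
    ellipseRadius τ x + ellipseRadius τ (-x) = 2 * (1 - τ ^ 2) / (1 - τ ^ 2 * x ^ 2) := by
  have h := (one_sub_mul_pos hτ hx).ne'
  have h' : 1 + τ * x ≠ 0 := by
    rw [← sub_neg_eq_add, ← mul_neg]
    exact (one_sub_mul_pos hτ ((abs_neg x).trans_le hx)).ne'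
  rw [show 1 - τ ^ 2 * x ^ 2 = (1 - τ * x) * (1 + τ * x) by ring, ellipseRadius, ellipseRadius,
    mul_neg, sub_neg_eq_add]
  field_simp
  ring

lemma ellipseRadius_add_ellipseRadius_neg_le (h₀ : 0 ≤ τ) (h : τ ≤ τ') (h₁ : τ' < 1)
    (hx : |x| ≤ 1) : ellipseRadius τ' x + ellipseRadius τ' (-x) ≤
      ellipseRadius τ x + ellipseRadius τ (-x) := by
  have hden : ∀ {t : ℝ}, 0 ≤ t → t < 1 → 0 < 1 - t ^ 2 * x ^ 2 := fun {t} ht₀ ht₁ => by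
    rw [← mul_pow, sub_pos, sq_lt_one_iff_abs_lt_one, abs_mul, abs_of_nonneg ht₀]
    exact (mul_le_of_le_one_right ht₀ hx).trans_lt ht₁
  have hsq : τ ^ 2 ≤ τ' ^ 2 := by gcongr
  have hx2 : x ^ 2 ≤ 1 := (sq_le_one_iff_abs_le_one x).2 hx
  rw [ellipseRadius_add_ellipseRadius_neg (abs_lt.2 ⟨by linarith, h₁⟩) hx,
    ellipseRadius_add_ellipseRadius_neg (abs_lt.2 ⟨by linarith, h.trans_lt h₁⟩) hx,
    div_le_div_iff₀ (hden (h₀.trans h) h₁) (hden h₀ (h.trans_lt h₁))]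
  linarith [mul_nonneg (sub_nonneg.2 hsq) (sub_nonneg.2 hx2)]

lemma ellipseRadius_neg_le (h₀ : 0 ≤ τ) (h : τ ≤ τ') (h₁ : τ ≤ 1) (hx₀ : 0 ≤ x) :
    ellipseRadius τ' (-x) ≤ ellipseRadius τ (-x) := by
  have hsq : τ ^ 2 ≤ 1 := pow_le_one₀ h₀ h₁
  rw [ellipseRadius, ellipseRadius, mul_neg, mul_neg, sub_neg_eq_add, sub_neg_eq_add]
  gcongr

lemma ellipseRadius_neg_le_ellipseRadius (h₀ : 0 ≤ τ) (h₁ : τ < 1) (hx₀ : 0 ≤ x) (hx₁ : x ≤ 1) :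
    ellipseRadius τ (-x) ≤ ellipseRadius τ x := by
  have hsq : τ ^ 2 ≤ 1 := pow_le_one₀ h₀ h₁.le
  have hpos := one_sub_mul_pos (abs_lt.2 ⟨by linarith, h₁⟩) (abs_le.2 ⟨by linarith, hx₁⟩)
  rw [ellipseRadius, ellipseRadius]
  gcongr
  linarith

/- For each single `x` the kernel is not monotone in `τ`; the sum over `± x` is, since the two radii
`a ≥ b` move to `a' + b' ≤ a + b`, `b' ≤ b`, and `r ↦ (1 + ρ r)⁻¹ᐟ²` is decreasing and convex. -/
lemma rotationKernel_add_rotationKernel_neg_le (hρ : 0 ≤ ρ) (h₀ : 0 ≤ τ) (h : τ ≤ τ') (h₁ : τ' ≤ 1)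
    (hx : |x| ≤ 1) : rotationKernel ρ τ x + rotationKernel ρ τ (-x) ≤
      rotationKernel ρ τ' x + rotationKernel ρ τ' (-x) := by
  wlog hx₀ : 0 ≤ x generalizing x
  · simpa only [neg_neg, add_comm] using
      this ((abs_neg x).trans_le hx) (neg_nonneg.2 (not_le.1 hx₀).le)
  have hx' : |(-x)| ≤ 1 := (abs_neg x).trans_le hx
  rcases h₁.eq_or_lt with rfl | h₁
  · rw [rotationKernel_one, rotationKernel_one]
    exact add_le_add (rotationKernel_le_one hρ h₀ h hx) (rotationKernel_le_one hρ h₀ h hx')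
  have hτ : |τ| < 1 := abs_lt.2 ⟨by linarith, h.trans_lt h₁⟩
  have hτ' : |τ'| < 1 := abs_lt.2 ⟨by linarith, h₁⟩
  have hpos : ∀ {t y : ℝ}, |t| < 1 → |y| ≤ 1 → 0 < 1 + ρ * ellipseRadius t y := fun ht hy =>
    add_pos_of_pos_of_nonneg one_pos (mul_nonneg hρ (ellipseRadius_pos ht hy).le)
  refine inv_sqrt_add_inv_sqrt_le (hpos hτ hx') ?_ (hpos hτ' hx) (hpos hτ' hx') ?_ ?_
  · gcongr
    exact ellipseRadius_neg_le_ellipseRadius h₀ (h.trans_lt h₁) hx₀ (abs_le.1 hx).2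
  · gcongr
    exact ellipseRadius_neg_le h₀ h (h.trans h₁.le) hx₀
  · linarith [mul_le_mul_of_nonneg_left (ellipseRadius_add_ellipseRadius_neg_le h₀ h h₁ hx) hρ]

lemma strictMonoOn_rotationKernel_zero (hρ : 0 < ρ) :
    StrictMonoOn (fun τ => rotationKernel ρ τ 0) (Set.Icc 0 1) := by
  intro τ hτ τ' hτ' h
  have hsq : τ ^ 2 < τ' ^ 2 := pow_lt_pow_left₀ h hτ.1 two_ne_zero
  have hsq' : τ' ^ 2 ≤ 1 := pow_le_one₀ hτ'.1 hτ'.2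
  simp only [rotationKernel, ellipseRadius, mul_zero, sub_zero, div_one]
  gcongr

lemma continuous_rotationKernel_neg_cos (hρ : 0 ≤ ρ) (h₀ : 0 ≤ τ) (h₁ : τ ≤ 1) :
    Continuous fun ψ => rotationKernel ρ τ (-Real.cos ψ) := by
  have h := (continuous_rotationKernel_cos hρ h₀ h₁).comp (continuous_add_const Real.pi)
  simpa only [Function.comp_def, Real.cos_add_pi] using h

lemma integral_rotationKernel_neg_cos (ρ τ : ℝ) :
    ∫ ψ in (0 : ℝ)..2 * Real.pi, rotationKernel ρ τ (-Real.cos ψ) = rotationIntegral ρ τ := by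
  have hper := (Real.cos_periodic.comp (rotationKernel ρ τ)).intervalIntegral_add_eq Real.pi 0
  simp only [rotationIntegral, ← Real.cos_add_pi]
  rw [intervalIntegral.integral_comp_add_right fun ψ => rotationKernel ρ τ (Real.cos ψ)]
  simpa only [zero_add, add_comm (2 * Real.pi), Function.comp_apply] using hper

lemma rotationIntegral_eq_integral_add (hρ : 0 ≤ ρ) (h₀ : 0 ≤ τ) (h₁ : τ ≤ 1) :
    rotationIntegral ρ τ = (∫ ψ in (0 : ℝ)..2 * Real.pi,
      (rotationKernel ρ τ (Real.cos ψ) + rotationKernel ρ τ (-Real.cos ψ))) / 2 := by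
  rw [intervalIntegral.integral_add
    ((continuous_rotationKernel_cos hρ h₀ h₁).intervalIntegrable _ _)
    ((continuous_rotationKernel_neg_cos hρ h₀ h₁).intervalIntegrable _ _),
    integral_rotationKernel_neg_cos, ← rotationIntegral, add_self_div_two]

lemma strictMonoOn_rotationIntegral (hρ : 0 < ρ) :
    StrictMonoOn (rotationIntegral ρ) (Set.Icc 0 1) := by
  intro τ hτ τ' hτ' h
  have hc : ∀ {t : ℝ}, t ∈ Set.Icc (0 : ℝ) 1 → Continuous fun ψ =>
      rotationKernel ρ t (Real.cos ψ) + rotationKernel ρ t (-Real.cos ψ) := fun ht =>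
    (continuous_rotationKernel_cos hρ.le ht.1 ht.2).add
      (continuous_rotationKernel_neg_cos hρ.le ht.1 ht.2)
  rw [rotationIntegral_eq_integral_add hρ.le hτ.1 hτ.2,
    rotationIntegral_eq_integral_add hρ.le hτ'.1 hτ'.2]
  refine div_lt_div_of_pos_right
    (intervalIntegral.integral_lt_integral_of_continuousOn_of_le_of_exists_lt Real.two_pi_pos
      (hc hτ).continuousOn (hc hτ').continuousOn (fun ψ _ =>
        rotationKernel_add_rotationKernel_neg_le hρ.le hτ.1 h.le hτ'.2 (Real.abs_cos_le_one ψ))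
      ⟨Real.pi / 2, ⟨by positivity, by linarith [Real.pi_pos]⟩, ?_⟩) two_pos
  have hlt := strictMonoOn_rotationKernel_zero hρ hτ hτ' h
  rw [Real.cos_pi_div_two, neg_zero]
  exact add_lt_add hlt hlt

end RotationIntegral

section ParameterPath

lemma continuousOn_of_strictMonoOn_of_eq {X : Type*} [TopologicalSpace X] {F : X → ℝ → ℝ}
    {g : X → ℝ} {s : Set X} {a b y : ℝ}
    (hF : ∀ u ∈ Set.Icc a b, ContinuousOn (fun x => F x u) s)
    (hmono : ∀ x ∈ s, StrictMonoOn (F x) (Set.Icc a b))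
    (hg : ∀ x ∈ s, g x ∈ Set.Icc a b ∧ F x (g x) = y) : ContinuousOn g s := by
  intro x hx
  obtain ⟨hgx, hy⟩ := hg x hx
  refine tendsto_order.2 ⟨fun u hu => ?_, fun u hu => ?_⟩
  · rcases lt_or_ge u a with hua | hua
    · filter_upwards [self_mem_nhdsWithin] with z hz using hua.trans_le (hg z hz).1.1
    · have hut : u ∈ Set.Icc a b := ⟨hua, hu.le.trans hgx.2⟩
      filter_upwards [self_mem_nhdsWithin, (hF u hut x hx).eventually_lt_const
        (((hmono x hx).lt_iff_lt hut hgx).2 hu)] with z hz hlt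
      rw [hy, ← (hg z hz).2] at hlt
      exact ((hmono z hz).lt_iff_lt hut (hg z hz).1).1 hlt
  · rcases lt_or_ge b u with hub | hub
    · filter_upwards [self_mem_nhdsWithin] with z hz using (hg z hz).1.2.trans_lt hub
    · have hut : u ∈ Set.Icc a b := ⟨hgx.1.trans hu.le, hub⟩
      filter_upwards [self_mem_nhdsWithin, (hF u hut x hx).eventually_const_lt
        (((hmono x hx).lt_iff_lt hgx hut).2 hu)] with z hz hlt
      rw [hy, ← (hg z hz).2] at hlt
      exact ((hmono z hz).lt_iff_lt (hg z hz).1 hut).1 hlt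

lemma exists_first_zero {H : ℝ → ℝ} {a ℓ : ℝ} (hc : ContinuousOn H (Set.Icc a ℓ)) (h : a ≤ ℓ)
    (ha : 0 < H a) (hℓ : H ℓ ≤ 0) :
    ∃ b ∈ Set.Ioc a ℓ, H b = 0 ∧ ∀ s ∈ Set.Ico a b, 0 < H s := by
  have hzero : ∀ s ∈ Set.Icc a ℓ, H s ≤ 0 → ∃ z ∈ Set.Icc a s, H z = 0 := fun s hs hHs =>
    intermediate_value_Icc' hs.1 (hc.mono (Set.Icc_subset_Icc_right hs.2)) ⟨hHs, ha.le⟩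
  have hcompact : IsCompact (Set.Icc a ℓ ∩ H ⁻¹' {0}) :=
    isCompact_Icc.of_isClosed_subset
      (hc.preimage_isClosed_of_isClosed isClosed_Icc isClosed_singleton) Set.inter_subset_left
  obtain ⟨z, hz, hHz⟩ := hzero ℓ ⟨h, le_rfl⟩ hℓ
  obtain ⟨b, ⟨hb, hHb⟩, hmin⟩ := hcompact.exists_isLeast ⟨z, hz, hHz⟩
  refine ⟨b, ⟨hb.1.lt_of_ne ?_, hb.2⟩, hHb, fun s hs => ?_⟩
  · rintro rfl
    exact ha.ne' hHb
  · by_contra! hHs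
    have hsℓ : s ∈ Set.Icc a ℓ := ⟨hs.1, hs.2.le.trans hb.2⟩
    obtain ⟨z, hz, hHz⟩ := hzero s hsℓ hHs
    exact (hz.2.trans_lt hs.2).not_ge (hmin ⟨⟨hz.1, hz.2.trans hsℓ.2⟩, hHz⟩)

lemma exists_injective_rat_values {Ψ : ℝ → ℝ} {a b w : ℝ} (hab : a ≤ b) (hw : 0 < w)
    (hc : ContinuousOn Ψ (Set.Icc a b)) (hlt : Ψ a < Ψ b) :
    ∃ (r : ℕ → ℚ) (t : ℕ → ℝ), Function.Injective r ∧
      ∀ n, t n ∈ Set.Ioo a b ∧ Ψ (t n) = w * r n := by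
  obtain ⟨q₁, h₁, hlt₁⟩ := exists_rat_btwn (div_lt_div_of_pos_right hlt hw)
  obtain ⟨q₂, h₁₂, h₂⟩ := exists_rat_btwn hlt₁
  have hinf : (Set.Ioo q₁ q₂).Infinite := Set.Ioo_infinite (by exact_mod_cast h₁₂)
  have hvalue : ∀ r : Set.Ioo q₁ q₂, ∃ t ∈ Set.Ioo a b, Ψ t = w * (r : ℚ) := by
    rintro ⟨r, hr₁, hr₂⟩
    refine intermediate_value_Ioo hab hc ⟨?_, ?_⟩
    · exact (div_lt_iff₀' hw).1 (h₁.trans (by exact_mod_cast hr₁))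
    · exact (lt_div_iff₀' hw).1 ((show (r : ℝ) < q₂ by exact_mod_cast hr₂).trans h₂)
  choose t ht hΨ using hvalue
  let r := hinf.natEmbedding
  exact ⟨fun n => r n, fun n => t (r n), Subtype.val_injective.comp r.injective,
    fun n => ⟨ht (r n), hΨ (r n)⟩⟩

lemma exists_continuousOn_rotationIntegral_eq {s : Set ℝ} {f : ℝ → ℝ} {w : ℝ}
    (hf : ContinuousOn f s) (hpos : ∀ L ∈ s, 0 < f L)
    (h₀ : ∀ L ∈ s, 2 * Real.pi / √(1 + f L) < w) (h₁ : w < 2 * Real.pi) :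
    ∃ τ : ℝ → ℝ, ContinuousOn τ s ∧
      ∀ L ∈ s, τ L ∈ Set.Ioo 0 1 ∧ rotationIntegral (f L) (τ L) = w := by
  have hex : ∀ L, ∃ t, L ∈ s → t ∈ Set.Ioo (0 : ℝ) 1 ∧ rotationIntegral (f L) t = w := fun L => by
    by_cases hL : L ∈ s
    · have hc : ContinuousOn (rotationIntegral (f L)) (Set.Icc 0 1) :=
        continuousOn_rotationIntegral.comp (continuousOn_const.prodMk continuousOn_id)
          fun t ht => ⟨(hpos L hL).le, ht⟩
      obtain ⟨t, ht, hw⟩ := intermediate_value_Ioo zero_le_one hc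
        (show w ∈ Set.Ioo (rotationIntegral (f L) 0) (rotationIntegral (f L) 1) from
          ⟨(rotationIntegral_zero _).trans_lt (h₀ L hL), h₁.trans_eq (rotationIntegral_one _).symm⟩)
      exact ⟨t, fun _ => ⟨ht, hw⟩⟩
    · exact ⟨0, fun h => absurd h hL⟩
  choose τ hτ using hex
  refine ⟨τ, continuousOn_of_strictMonoOn_of_eq (F := fun L => rotationIntegral (f L))
    (fun t ht => ?_) (fun L hL => strictMonoOn_rotationIntegral (hpos L hL))
    fun L hL => ⟨Set.Ioo_subset_Icc_self (hτ L hL).1, (hτ L hL).2⟩, hτ⟩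
  exact continuousOn_rotationIntegral.comp (hf.prodMk continuousOn_const)
    fun L hL => ⟨(hpos L hL).le, ht⟩

/-- The parameter `ρ` of the `m + 2` rotation for the mean curvature `c = -1 - 1 / L`. -/
noncomputable def plusRatio (m L : ℝ) : ℝ := (1 + L * (m + 3)) / 2

/-- Twice the `m - 2` rotation angle for `c = -1 - 1 / L` and the amplitude `δ` at which the
parameter `τ` of the `m + 2` rotation is `t`. -/
noncomputable def minusIntegral (m L t : ℝ) : ℝ :=
  rotationIntegral ((plusRatio m L - 2 * L) / (1 + 2 * L))
    (t * plusRatio m L / (plusRatio m L - 2 * L))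

lemma continuous_plusRatio (m : ℝ) : Continuous (plusRatio m) := by
  unfold plusRatio
  fun_prop

lemma exists_two_mul_lt_plusRatio (m : ℝ) : ∃ ℓ > 0, ∀ L ∈ Set.Icc 0 ℓ, 2 * ℓ < plusRatio m L := by
  refine ⟨(9 + 2 * |m + 3|)⁻¹, by positivity, fun L hL => ?_⟩
  have hbound : (9 + 2 * |m + 3|)⁻¹ * (9 + 2 * |m + 3|) = 1 := inv_mul_cancel₀ (by positivity)
  have hL' := mul_le_mul_of_nonneg_right hL.2 (abs_nonneg (m + 3))
  have habs := mul_le_mul_of_nonneg_left (neg_abs_le (m + 3)) hL.1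
  have hpos : 0 < (9 + 2 * |m + 3|)⁻¹ := by positivity
  rw [plusRatio]
  linarith

lemma mul_one_sub_lt_of_lt_rotationIntegral {ρ τ ε : ℝ} (hρ : 0 ≤ ρ) (h₀ : 0 ≤ τ) (h₁ : τ < 1)
    (hε : 0 ≤ ε) (h : 2 * Real.pi / √(1 + ε) < rotationIntegral ρ τ) : ρ * (1 - τ) < ε := by
  have hlt := h.trans_le (rotationIntegral_le hρ h₀ h₁)
  have hτ := mul_nonneg hρ (sub_nonneg.2 h₁.le)
  rw [div_lt_div_iff_of_pos_left Real.two_pi_pos (Real.sqrt_pos.2 (by linarith))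
    (Real.sqrt_pos.2 (by linarith)), Real.sqrt_lt_sqrt_iff (by linarith)] at hlt
  linarith

lemma continuousOn_minusIntegral {m : ℝ} {τ : ℝ → ℝ} {s : Set ℝ} (hτ : ContinuousOn τ s)
    (h : ∀ L ∈ s, 0 ≤ L ∧ 0 ≤ τ L ∧ 2 * L < plusRatio m L ∧ 2 * L ≤ plusRatio m L * (1 - τ L)) :
    ContinuousOn (fun L => minusIntegral m L (τ L)) s := by
  have hρ := (continuous_plusRatio m).continuousOn (s := s)
  have hpos : ∀ L ∈ s, 0 < plusRatio m L - 2 * L := fun L hL => sub_pos.2 (h L hL).2.2.1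
  have hden : ∀ L ∈ s, 0 < 1 + 2 * L := fun L hL => by linarith [(h L hL).1]
  have hratio : ContinuousOn (fun L => (plusRatio m L - 2 * L) / (1 + 2 * L)) s :=
    ContinuousOn.div (by fun_prop) (by fun_prop) fun L hL => (hden L hL).ne'
  have hecc : ContinuousOn (fun L => τ L * plusRatio m L / (plusRatio m L - 2 * L)) s :=
    ContinuousOn.div (by fun_prop) (by fun_prop) fun L hL => (hpos L hL).ne'
  refine continuousOn_rotationIntegral.comp (hratio.prodMk hecc) fun L hL => ?_
  obtain ⟨hL₀, hτ₀, hlt, hle⟩ := h L hL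
  exact ⟨div_nonneg (hpos L hL).le (hden L hL).le,
    div_nonneg (mul_nonneg hτ₀ (by linarith)) (hpos L hL).le,
    (div_le_one (hpos L hL)).2 (by linarith)⟩

/- The level set `rotationIntegral (plusRatio m L) τ = 2 π q` is a graph over `L ∈ [0, ℓ]`, and
it lies beyond the boundary `2 L = plusRatio m L * (1 - τ)` of the admissible region at `L = ℓ`. -/
lemma exists_levelCurve (m : ℝ) : ∃ (q : ℚ) (ℓ : ℝ) (τ : ℝ → ℝ), q < 1 ∧ 0 < ℓ ∧
    ContinuousOn τ (Set.Icc 0 ℓ) ∧ plusRatio m ℓ * (1 - τ ℓ) < 2 * ℓ ∧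
    ∀ L ∈ Set.Icc 0 ℓ, 2 * ℓ < plusRatio m L ∧ τ L ∈ Set.Ioo 0 1 ∧
      rotationIntegral (plusRatio m L) (τ L) = 2 * Real.pi * q := by
  obtain ⟨ℓ, hℓ, hρ⟩ := exists_two_mul_lt_plusRatio m
  have hsqrt : 1 < √(1 + 2 * ℓ) := (Real.lt_sqrt zero_le_one).2 (by linarith)
  obtain ⟨q, hq, hq₁⟩ := exists_rat_btwn (inv_lt_one_of_one_lt₀ hsqrt)
  have hw : 2 * Real.pi / √(1 + 2 * ℓ) < 2 * Real.pi * q :=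
    mul_lt_mul_of_pos_left hq Real.two_pi_pos
  have hρ₀ : ∀ L ∈ Set.Icc 0 ℓ, 0 < plusRatio m L := fun L hL => by linarith [hρ L hL]
  obtain ⟨τ, hτc, hτ⟩ := exists_continuousOn_rotationIntegral_eq
    (continuous_plusRatio m).continuousOn hρ₀
    (fun L hL => hw.trans' (by have := hρ L hL; gcongr))
    (mul_lt_of_lt_one_right Real.two_pi_pos hq₁)
  have hmem : ℓ ∈ Set.Icc 0 ℓ := ⟨hℓ.le, le_rfl⟩
  obtain ⟨⟨hτ₀, hτ₁⟩, heq⟩ := hτ ℓ hmem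
  exact ⟨q, ℓ, τ, by exact_mod_cast hq₁, hℓ, hτc,
    mul_one_sub_lt_of_lt_rotationIntegral (hρ₀ ℓ hmem).le hτ₀.le hτ₁ (by linarith)
      (hw.trans_eq heq.symm), fun L hL => ⟨hρ L hL, hτ L hL⟩⟩

lemma exists_parameterPath (m : ℝ) : ∃ (q : ℚ) (τ : ℝ → ℝ) (b : ℝ), 0 < b ∧
    ContinuousOn (fun L => minusIntegral m L (τ L)) (Set.Icc 0 b) ∧
    minusIntegral m 0 (τ 0) < minusIntegral m b (τ b) ∧
    ∀ L ∈ Set.Ioo 0 b, 0 < τ L ∧ 0 < plusRatio m L ∧ 2 * L < plusRatio m L * (1 - τ L) ∧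
      rotationIntegral (plusRatio m L) (τ L) = 2 * Real.pi * q := by
  obtain ⟨q, ℓ, τ, hq, hℓ, hτc, hend, hτ⟩ := exists_levelCurve m
  have hc : ContinuousOn (fun L => plusRatio m L * (1 - τ L) - 2 * L) (Set.Icc 0 ℓ) := by
    have := continuous_plusRatio m
    fun_prop
  obtain ⟨hρ₀, ⟨-, hτ₁⟩, heq₀⟩ := hτ 0 ⟨le_rfl, hℓ.le⟩
  obtain ⟨b, hb, hgap₀, hgap⟩ := exists_first_zero hc hℓ.le
    (by linarith [mul_pos ((mul_pos two_pos hℓ).trans hρ₀) (sub_pos.2 hτ₁)]) (by linarith)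
  have hsub : Set.Icc 0 b ⊆ Set.Icc 0 ℓ := Set.Icc_subset_Icc_right hb.2
  have hgap' : ∀ L ∈ Set.Icc 0 b, 2 * L ≤ plusRatio m L * (1 - τ L) := fun L hL => by
    rcases hL.2.eq_or_lt with rfl | hlt
    · exact (sub_eq_zero.1 hgap₀).ge
    · exact (sub_pos.1 (hgap L ⟨hL.1, hlt⟩)).le
  have hρb : 2 * b < plusRatio m b := by linarith [(hτ b ⟨hb.1.le, hb.2⟩).1, hb.2]
  have hval₀ : minusIntegral m 0 (τ 0) = 2 * Real.pi * q := by
    have hne : plusRatio m 0 ≠ 0 := ((mul_pos two_pos hℓ).trans hρ₀).ne'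
    rw [minusIntegral, mul_zero, sub_zero, add_zero, div_one, mul_div_cancel_right₀ _ hne, heq₀]
  have hvalb : minusIntegral m b (τ b) = 2 * Real.pi := by
    rw [minusIntegral, (div_eq_one_iff_eq (sub_pos.2 hρb).ne').2 (by linarith),
      rotationIntegral_one]
  refine ⟨q, τ, b, hb.1, continuousOn_minusIntegral (hτc.mono hsub) fun L hL => ?_, ?_,
    fun L hL => ?_⟩
  · obtain ⟨hρL, hτL, -⟩ := hτ L (hsub hL)
    exact ⟨hL.1, hτL.1.le, by linarith [hL.2, hb.2], hgap' L hL⟩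
  · rw [hval₀, hvalb]
    exact mul_lt_of_lt_one_right Real.two_pi_pos (by exact_mod_cast hq)
  · obtain ⟨hρL, hτL, heq⟩ := hτ L (hsub (Set.Ioo_subset_Icc_self hL))
    exact ⟨hτL.1, (mul_pos two_pos hℓ).trans hρL, sub_pos.1 (hgap L (Set.Ioo_subset_Ico_self hL)),
      heq⟩

variable {m L t : ℝ} {q r : ℚ}

lemma rotation_add_two (hL : 0 < L) (ht : 0 < t) (hρ : 0 < plusRatio m L)
    (h : 2 * L < plusRatio m L * (1 - t)) :
    rotation m (-1 - 1 / L) (2 * t * plusRatio m L / L) (m + 2) =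
      rotationIntegral (plusRatio m L) t / 2 := by
  have hp : m + 2 - (-1 - 1 / L) = 2 * plusRatio m L / L := by
    rw [plusRatio]
    field_simp
    ring
  have hq : m - 2 * (-1 - 1 / L) - (m + 2) = 2 / L := by ring
  have ht₁ : t < 1 := sub_pos.1 (pos_of_mul_pos_right ((mul_pos two_pos hL).trans h) hρ.le)
  have hrot := rotation_eq (m := m) (c := -1 - 1 / L) (p := m + 2) (τ := t)
    (by rw [hp]; positivity) (by rw [hq]; positivity) (abs_lt.2 ⟨by linarith, ht₁⟩)
  rw [hp, hq, div_div_div_cancel_right₀ hL.ne', mul_div_cancel_left₀ _ two_ne_zero] at hrot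
  rw [← hrot]
  congr 1
  ring

lemma rotation_sub_two (hL : 0 < L) (ht : 0 < t) (hρ : 0 < plusRatio m L)
    (h : 2 * L < plusRatio m L * (1 - t)) :
    rotation m (-1 - 1 / L) (2 * t * plusRatio m L / L) (m - 2) = minusIntegral m L t / 2 := by
  have htρ := mul_pos ht hρ
  have hgap : 0 < plusRatio m L - 2 * L := by linarith
  have hp : m - 2 - (-1 - 1 / L) = 2 * (plusRatio m L - 2 * L) / L := by
    rw [plusRatio]
    field_simp
    ring
  have hq : m - 2 * (-1 - 1 / L) - (m - 2) = 2 * (1 + 2 * L) / L := by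
    field_simp
    ring
  have hτ : t * plusRatio m L / (plusRatio m L - 2 * L) < 1 := by
    rw [div_lt_one hgap]
    linarith
  have hrot := rotation_eq (m := m) (c := -1 - 1 / L) (p := m - 2)
    (τ := t * plusRatio m L / (plusRatio m L - 2 * L)) (by rw [hp]; positivity)
    (by rw [hq]; positivity) (by rwa [abs_of_pos (by positivity)])
  rw [hp, hq, div_div_div_cancel_right₀ hL.ne', mul_div_mul_left _ _ two_ne_zero] at hrot
  rw [minusIntegral, ← hrot]
  congr 1
  field_simp

lemma exists_isTrajectory_of_rotationIntegral_eq (hL : 0 < L) (ht : 0 < t)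
    (hρ : 0 < plusRatio m L) (h : 2 * L < plusRatio m L * (1 - t))
    (hq : rotationIntegral (plusRatio m L) t = 2 * Real.pi * q)
    (hr : minusIntegral m L t = 2 * Real.pi * r) :
    ∃ (γ : Curve) (c δ : ℝ), IsTrajectory m γ ∧ IsPeriodic γ ∧ 0 < δ ∧
      HasCurvatureRange γ (Set.Icc (c - δ) (c + δ)) ∧ rotation m c δ (m - 2) = Real.pi * r := by
  have hplus : rotation m (-1 - 1 / L) (2 * t * plusRatio m L / L) (m + 2) = Real.pi * q := by
    rw [rotation_add_two hL ht hρ h, hq]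
    ring
  have hminus : rotation m (-1 - 1 / L) (2 * t * plusRatio m L / L) (m - 2) = Real.pi * r := by
    rw [rotation_sub_two hL ht hρ h, hr]
    ring
  have hδ : 0 < 2 * t * plusRatio m L / L := by positivity
  have hupper : m - 2 - (-1 - 1 / L + 2 * t * plusRatio m L / L) =
      2 * (plusRatio m L * (1 - t) - 2 * L) / L := by
    rw [plusRatio]
    field_simp
    ring
  have hupper₀ : 0 < 2 * (plusRatio m L * (1 - t) - 2 * L) / L := div_pos (by linarith) hL
  obtain ⟨γ, htraj, hper, hrange⟩ := exists_isTrajectory_isPeriodic hδ (by linarith)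
    (by linarith [one_div_pos.2 hL]) hplus hminus
  exact ⟨γ, _, _, htraj, hper, hδ, hrange, hminus⟩

end ParameterPath

end AdS

theorem theoremB_general (m : ℝ) :
    ∃ γ : ℕ → AdS.Curve,
      (∀ n, AdS.IsTrajectory m (γ n) ∧ AdS.IsPeriodic (γ n)) ∧
      ∀ i j, i ≠ j → ¬ AdS.Equivalent (γ i) (γ j) := by
  obtain ⟨q, τ, b, hb, hc, hlt, hpath⟩ := AdS.exists_parameterPath m
  obtain ⟨r, L, hr, hL⟩ := AdS.exists_injective_rat_values hb.le Real.two_pi_pos hc hlt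
  have hcurve := fun n => by
    obtain ⟨hτ, hρ, hgap, hq⟩ := hpath (L n) (hL n).1
    exact AdS.exists_isTrajectory_of_rotationIntegral_eq (hL n).1.1 hτ hρ hgap hq (hL n).2
  choose γ c δ htraj hper hδ hrange hrot using hcurve
  refine ⟨γ, fun n => ⟨htraj n, hper n⟩, fun i j hij he => hij (hr ?_)⟩
  have hIcc := (hrange i).eq_of_equivalent (hrange j) he
  rw [Set.Icc_eq_Icc_iff (by linarith [hδ i])] at hIcc
  have hcij : c i = c j := by linarith [hIcc.1, hIcc.2]
  have hδij : δ i = δ j := by linarith [hIcc.1, hIcc.2]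
  have hπ : Real.pi * r i = Real.pi * r j := by rw [← hrot i, ← hrot j, hcij, hδij]
  exact_mod_cast mul_left_cancel₀ Real.pi_pos.ne' hπ

theorem theoremB :
    ∃ M₀ : Set ℝ, IsClosed M₀ ∧ IsDiscrete M₀ ∧
      ∀ m : ℝ, m ∉ M₀ →
        ∃ γ : ℕ → AdS.Curve,
          (∀ n, AdS.IsTrajectory m (γ n) ∧ AdS.IsPeriodic (γ n)) ∧
          ∀ i j, i ≠ j → ¬ AdS.Equivalent (γ i) (γ j) :=
  ⟨∅, isClosed_empty, Set.subsingleton_empty.isDiscrete, fun m _ => theoremB_general m⟩
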